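/- Let $R$ be a reduced crystallographic root system (possibly reducible) spanning $\mathfrak h_{\mathbb R}^*$, where $\mathfrak h_{\mathbb R}$ is a finite-dimensional real vector space; let $W$ be its Weyl group, $R_+\subset R$ a system of positive roots, $Q^\vee\subset\mathfrak h_{\mathbb R}$ the coroot lattice and $P=\{\lambda\in\mathfrak h_{\mathbb R}^*:\langle\lambda,\alpha^\vee\rangle\in\mathbb Z\ \text{for all }\alpha\in R\}$ the weight lattice. Fix a $W$-invariant inner product on $\mathfrak h_{\mathbb R}$ and denote by $|\cdot|$ also the dual norm on $\mathfrak h_{\mathbb R}^*$. Let $T=\mathfrak h_{\mathbb R}/2\pi Q^\vee$, let $\mu$ be the normalized Haar measure on $T$, and let $L^2(T,d\mu)^W$ be the Hilbert space of $W$-invariant elements of $L^2(T,d\mu)$. Let $k_\alpha$ $(\alpha\in R)$ be real numbers with $k_{w\alpha}=k_\alpha$ for all $w\in W$, and put $$V(h)=\sum_{\alpha\in R_+}k_\alpha(k_\alpha-1)|\alpha|^2\Bigl(\frac{1}{4\sin^2(\langle\alpha,h\rangle/2)}-\frac1{12}\Bigr).$$ The trigonometric Calogero–Sutherland Hamiltonian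 is the operator $\mathcal H_T=-\nabla^2+V$ in $L^2(T,d\mu)^W$, where $\nabla^2$ is the Laplacian on $T$, with domain $\{f\in C^2(T)^W: Vf\in L^2(T,d\mu)\}$. Let $\mathbb C[P]^W$ be the space of $W$-invariant trigonometric polynomials on $T$, i.e. $W$-invariant finite linear combinations of the functions $e^{\lambda}(h)=e^{\sqrt{-1}\langle\lambda,h\rangle}$, $\lambda\in P$, and let $$\Delta(h)=\prod_{\alpha\in R_+}|\sin(\langle\alpha,h\rangle/2)|^{k_\alpha},\qquad \mathcal P=\mathbb C[P]^W\cdot\Delta\subset L^2(T,d\mu)^W .$$ If $k_\alpha\ge 2$ for all $\alpha\in R$, then $\mathcal P$ is contained in the domain of $\mathcal H_T$, and $\mathcal H_T$ is essentially self-adjoint on $\mathcal P$: the restriction $\mathcal H_T|_{\mathcal P}$ is densely defined and symmetric, and its closure is self-adjoint. -/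

import Mathlib

open MeasureTheory Filter Topology
open scoped InnerProductSpace

set_option linter.unusedSectionVars false

noncomputable section

namespace CalogeroSutherland

section Torus

variable {ι M V : Type*} [AddCommGroup M] [Module ℝ M]
  [NormedAddCommGroup V] [InnerProductSpace ℝ V] [FiniteDimensional ℝ V]

/-- The lattice `2π Q^∨` in `V = 𝔥_ℝ`, where `Q^∨` is the coroot lattice. -/
def periodLattice (P : RootPairing ι ℝ M V) : AddSubgroup V :=
  AddSubgroup.closure (Set.range fun i => (2 * Real.pi) • P.coroot i)

/-- The torus `T = 𝔥_ℝ / 2π Q^∨`. -/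
def Torus (P : RootPairing ι ℝ M V) : Type _ := V ⧸ periodLattice P

instance (P : RootPairing ι ℝ M V) : AddCommGroup (Torus P) :=
  inferInstanceAs (AddCommGroup (V ⧸ periodLattice P))

instance (P : RootPairing ι ℝ M V) : TopologicalSpace (Torus P) :=
  inferInstanceAs (TopologicalSpace (V ⧸ periodLattice P))

instance (P : RootPairing ι ℝ M V) : IsTopologicalAddGroup (Torus P) :=
  inferInstanceAs (IsTopologicalAddGroup (V ⧸ periodLattice P))

instance (P : RootPairing ι ℝ M V) : MeasurableSpace (Torus P) := borel _

instance (P : RootPairing ι ℝ M V) : BorelSpace (Torus P) := ⟨rfl⟩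

/-- The projection `𝔥_ℝ → T`. -/
def proj (P : RootPairing ι ℝ M V) : V →+ Torus P := QuotientAddGroup.mk' (periodLattice P)

lemma proj_surjective (P : RootPairing ι ℝ M V) : Function.Surjective (proj P) :=
  QuotientAddGroup.mk'_surjective _

lemma isQuotientMap_proj (P : RootPairing ι ℝ M V) : IsQuotientMap (proj P) :=
  isQuotientMap_quot_mk

lemma proj_eq_zero_iff (P : RootPairing ι ℝ M V) (v : V) :
    proj P v = 0 ↔ v ∈ periodLattice P :=
  QuotientAddGroup.eq_zero_iff v

/-- A function on `𝔥_ℝ` that is invariant under translations by `2π Q^∨`, as a function on `T`. -/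
def descend {α : Type*} (P : RootPairing ι ℝ M V) (f : V → α)
    (hf : ∀ v, ∀ l ∈ periodLattice P, f (v + l) = f v) : Torus P → α :=
  Quotient.lift f fun a b hab => by
    have h := QuotientAddGroup.leftRel_apply.mp hab
    have := hf a _ h
    rw [← this, add_neg_cancel_left]

lemma descend_proj {α : Type*} (P : RootPairing ι ℝ M V) (f : V → α)
    (hf : ∀ v, ∀ l ∈ periodLattice P, f (v + l) = f v) (v : V) :
    descend P f hf (proj P v) = f v := rfl

instance compactSpace_torus (P : RootPairing ι ℝ M V) [P.IsRootSystem] :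
    CompactSpace (Torus P) := by
  classical
  obtain ⟨s, hs, hspan, hlin⟩ := exists_linearIndependent ℝ (Set.range P.coroot)
  have hfin : Finite s := hlin.finite
  have := Fintype.ofFinite s
  set K : Set V := (fun c : s → ℝ => ∑ x : s, c x • (x : V)) ''
    (Set.univ.pi fun _ => Set.Icc (0 : ℝ) (2 * Real.pi)) with hK
  have hKc : IsCompact K :=
    (isCompact_univ_pi fun _ => isCompact_Icc).image (by fun_prop)
  have himg : (proj P) '' K = Set.univ := by
    refine Set.eq_univ_of_forall fun t => ?_
    obtain ⟨v, rfl⟩ := proj_surjective P t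
    have hv : v ∈ Submodule.span ℝ s := by
      rw [hspan, RootPairing.IsRootSystem.span_coroot_eq_top]; trivial
    obtain ⟨c, hc⟩ : ∃ c : s → ℝ, ∑ x : s, c x • (x : V) = v := by
      have hv' : v ∈ Submodule.span ℝ (Set.range ((↑) : s → V)) := by simpa using hv
      exact (Submodule.mem_span_range_iff_exists_fun ℝ).1 hv'
    have hpi : (0 : ℝ) < 2 * Real.pi := Real.two_pi_pos
    let n : s → ℤ := fun x => ⌊c x / (2 * Real.pi)⌋
    refine ⟨∑ x : s, (c x - n x * (2 * Real.pi)) • (x : V),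
      ⟨fun x => c x - n x * (2 * Real.pi), fun x _ => ?_, rfl⟩, ?_⟩
    · have h1 := Int.floor_le (c x / (2 * Real.pi))
      have h2 := (Int.lt_floor_add_one (c x / (2 * Real.pi))).le
      rw [le_div_iff₀ hpi] at h1
      rw [div_le_iff₀ hpi] at h2
      constructor
      · change 0 ≤ c x - n x * (2 * Real.pi)
        linarith
      · change c x - n x * (2 * Real.pi) ≤ 2 * Real.pi
        linarith
    · rw [← sub_eq_zero, ← map_sub, proj_eq_zero_iff, ← hc, ← Finset.sum_sub_distrib]
      refine AddSubgroup.sum_mem _ fun x _ => ?_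
      obtain ⟨i, hi⟩ := hs x.2
      have : (c x - n x * (2 * Real.pi)) • (x : V) - c x • (x : V)
          = (-n x) • ((2 * Real.pi) • P.coroot i) := by
        rw [← sub_smul, hi, ← Int.cast_smul_eq_zsmul ℝ, smul_smul]
        congr 1
        push_cast
        ring
      rw [this]
      have hmem : (2 * Real.pi) • P.coroot i ∈ periodLattice P :=
        AddSubgroup.subset_closure (Set.mem_range_self i)
      exact AddSubgroup.zsmul_mem _ hmem _
  have hc := hKc.image (isQuotientMap_proj P).continuous
  rw [himg] at hc
  exact ⟨hc⟩

/-- The normalized Haar measure `μ` on `T`. -/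
def haarT (P : RootPairing ι ℝ M V) [P.IsRootSystem] : Measure (Torus P) :=
  Measure.addHaarMeasure ⊤

instance (P : RootPairing ι ℝ M V) [P.IsRootSystem] : (haarT P).IsAddHaarMeasure :=
  inferInstanceAs (Measure.addHaarMeasure _).IsAddHaarMeasure

instance (P : RootPairing ι ℝ M V) [P.IsRootSystem] : IsProbabilityMeasure (haarT P) :=
  ⟨Measure.addHaarMeasure_self (K₀ := (⊤ : TopologicalSpace.PositiveCompacts (Torus P)))⟩

/-- The Weyl group `W` acting linearly on `𝔥_ℝ`: the group generated by the reflections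
`h ↦ h - ⟨α, h⟩ α^∨`. -/
def weylGroup (P : RootPairing ι ℝ M V) : Subgroup (V ≃ₗ[ℝ] V) :=
  Subgroup.closure (Set.range P.coreflection)

lemma weylGroup_mem_periodLattice (P : RootPairing ι ℝ M V) {w : V ≃ₗ[ℝ] V}
    (hw : w ∈ weylGroup P) : ∀ l ∈ periodLattice P, w l ∈ periodLattice P := by
  have key : ∀ i, ∀ l ∈ periodLattice P, P.coreflection i l ∈ periodLattice P := by
    intro i l hl
    induction hl using AddSubgroup.closure_induction with
    | mem x hx =>
      obtain ⟨j, rfl⟩ := hx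
      refine AddSubgroup.subset_closure ⟨P.reflectionPerm i j, ?_⟩
      simp
    | zero => simp
    | add x y _ _ hx hy => rw [map_add]; exact AddSubgroup.add_mem _ hx hy
    | neg x _ hx => rw [map_neg]; exact AddSubgroup.neg_mem _ hx
  induction hw using Subgroup.closure_induction'' with
  | one => exact fun l hl => hl
  | mem x hx => obtain ⟨i, rfl⟩ := hx; exact key i
  | inv_mem x hx => obtain ⟨i, rfl⟩ := hx; exact key i
  | mul x y _ _ hx hy => exact fun l hl => hx _ (hy l hl)

/-- The action of `w ∈ W` on `T`. -/
def weylTorus (P : RootPairing ι ℝ M V) (w : weylGroup P) : Torus P →+ Torus P :=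
  QuotientAddGroup.map (periodLattice P) (periodLattice P)
    ((w : V ≃ₗ[ℝ] V) : V →ₗ[ℝ] V).toAddMonoidHom
    fun l hl => weylGroup_mem_periodLattice P w.2 l hl

lemma weylTorus_proj (P : RootPairing ι ℝ M V) (w : weylGroup P) (v : V) :
    weylTorus P w (proj P v) = proj P ((w : V ≃ₗ[ℝ] V) v) := rfl

lemma continuous_weylTorus (P : RootPairing ι ℝ M V) (w : weylGroup P) :
    Continuous (weylTorus P w) := by
  rw [(isQuotientMap_proj P).continuous_iff]
  exact (isQuotientMap_proj P).continuous.comp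
    (LinearMap.continuous_of_finiteDimensional ((w : V ≃ₗ[ℝ] V) : V →ₗ[ℝ] V))

lemma measurePreserving_weylTorus (P : RootPairing ι ℝ M V) [P.IsRootSystem] (w : weylGroup P) :
    MeasurePreserving (weylTorus P w) (haarT P) (haarT P) := by
  refine AddMonoidHom.measurePreserving (continuous_weylTorus P w) (fun t => ?_) rfl
  obtain ⟨v, rfl⟩ := proj_surjective P t
  exact ⟨proj P ((w : V ≃ₗ[ℝ] V).symm v), by rw [weylTorus_proj]; simp⟩

/-- `W`-invariance of a function on `T`. -/
def IsWeylInvariant (P : RootPairing ι ℝ M V) (F : Torus P → ℂ) : Prop :=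
  ∀ (w : weylGroup P) (t : Torus P), F (weylTorus P w t) = F t

/-- The Hilbert space `L²(T, dμ)^W` of `W`-invariant elements of `L²(T, dμ)`. -/
def L2W (P : RootPairing ι ℝ M V) [P.IsRootSystem] : Submodule ℂ (Lp ℂ 2 (haarT P)) where
  carrier := {f | ∀ w : weylGroup P,
    Lp.compMeasurePreserving (weylTorus P w) (measurePreserving_weylTorus P w) f = f}
  add_mem' := fun {f g} hf hg w => by rw [map_add, hf w, hg w]
  zero_mem' := fun w => map_zero _
  smul_mem' := fun c f hf w => by
    have h := (Lp.compMeasurePreservingₗ ℂ (weylTorus P w)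
      (measurePreserving_weylTorus P w) : Lp ℂ 2 (haarT P) →ₗ[ℂ] _).map_smul c f
    exact h.trans (congrArg (c • ·) (hf w))

lemma isClosed_L2W (P : RootPairing ι ℝ M V) [P.IsRootSystem] :
    IsClosed (L2W P : Set (Lp ℂ 2 (haarT P))) := by
  have : (L2W P : Set (Lp ℂ 2 (haarT P))) = ⋂ w : weylGroup P, {f |
      Lp.compMeasurePreserving (weylTorus P w) (measurePreserving_weylTorus P w) f = f} := by
    ext f; simp [L2W]
  rw [this]
  exact isClosed_iInter fun w => isClosed_eq
    (Lp.isometry_compMeasurePreserving (measurePreserving_weylTorus P w)).continuous continuous_id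

instance (P : RootPairing ι ℝ M V) [P.IsRootSystem] : CompleteSpace (L2W P) :=
  (isClosed_L2W P).completeSpace_coe

/-- `F ∈ C²(T)`. -/
def IsC2 (P : RootPairing ι ℝ M V) (F : Torus P → ℂ) : Prop :=
  ContDiff ℝ 2 fun v => F (proj P v)

/-- The Laplacian on `T`, computed at `t` in the chart `v ↦ t + proj v`. -/
def laplacianT (P : RootPairing ι ℝ M V) (F : Torus P → ℂ) (t : Torus P) : ℂ :=
  Laplacian.laplacian (fun v : V => F (t + proj P v)) 0

lemma IsC2.translate {P : RootPairing ι ℝ M V} {F : Torus P → ℂ} (hF : IsC2 P F) (t : Torus P) :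
    ContDiff ℝ 2 fun v => F (t + proj P v) := by
  obtain ⟨s, rfl⟩ := proj_surjective P t
  simp only [← map_add]
  exact ContDiff.comp (g := fun v => F (proj P v)) hF (contDiff_const.add contDiff_id)

lemma IsC2.continuous {P : RootPairing ι ℝ M V} {F : Torus P → ℂ} (hF : IsC2 P F) :
    Continuous F :=
  (isQuotientMap_proj P).continuous_iff.2 (ContDiff.continuous hF)

end Torus

section Operators

variable {ι M V : Type*} [Fintype ι] [AddCommGroup M] [Module ℝ M]
  [NormedAddCommGroup V] [InnerProductSpace ℝ V] [FiniteDimensional ℝ V]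

/-- The weight lattice: all `λ ∈ 𝔥_ℝ^*` with `⟨λ, α^∨⟩ ∈ ℤ` for every root `α`. -/
def weightLattice (P : RootPairing ι ℝ M V) : AddSubgroup M where
  carrier := {x | ∀ i, ∃ n : ℤ, P.toLinearMap x (P.coroot i) = n}
  add_mem' := fun {x y} hx hy i => by
    obtain ⟨m, hm⟩ := hx i
    obtain ⟨n, hn⟩ := hy i
    exact ⟨m + n, by simp [hm, hn]⟩
  zero_mem' := fun i => ⟨0, by simp⟩
  neg_mem' := fun {x} hx i => by
    obtain ⟨m, hm⟩ := hx i
    exact ⟨-m, by simp [hm]⟩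

lemma root_mem_weightLattice (P : RootPairing ι ℝ M V) [P.IsCrystallographic] (i : ι) :
    P.root i ∈ weightLattice P := fun j => by
  obtain ⟨z, hz⟩ := P.exists_value (S := ℤ) i j
  exact ⟨z, hz.symm⟩

lemma weight_periodLattice (P : RootPairing ι ℝ M V) {x : M} (hx : x ∈ weightLattice P)
    {l : V} (hl : l ∈ periodLattice P) :
    ∃ n : ℤ, P.toLinearMap x l = n * (2 * Real.pi) := by
  induction hl using AddSubgroup.closure_induction with
  | mem y hy =>
    obtain ⟨j, rfl⟩ := hy
    obtain ⟨n, hn⟩ := hx j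
    exact ⟨n, by simp only [map_smul, hn, smul_eq_mul]; ring⟩
  | zero => exact ⟨0, by simp⟩
  | add y z _ _ hy hz =>
    obtain ⟨m, hm⟩ := hy
    obtain ⟨n, hn⟩ := hz
    exact ⟨m + n, by rw [map_add, hm, hn]; push_cast; ring⟩
  | neg y _ hy =>
    obtain ⟨m, hm⟩ := hy
    exact ⟨-m, by rw [map_neg, hm]; push_cast; ring⟩

/-- The function `e^λ` on `T`, `e^λ(h) = exp(√-1 ⟨λ, h⟩)`. -/
def expWeight (P : RootPairing ι ℝ M V) (x : weightLattice P) : Torus P → ℂ :=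
  descend P (fun h => Complex.exp (Complex.I * (P.toLinearMap (x : M) h : ℝ))) fun v l hl => by
    obtain ⟨n, hn⟩ := weight_periodLattice P x.2 hl
    rw [Complex.exp_eq_exp_iff_exists_int]
    exact ⟨n, by rw [map_add, hn]; push_cast; ring⟩

/-- The trigonometric polynomials `ℂ[P]`, as functions on `T`: the linear span of the `e^λ`. -/
def trigPolynomials (P : RootPairing ι ℝ M V) : Submodule ℂ (Torus P → ℂ) :=
  Submodule.span ℂ (Set.range (expWeight P))

/-- The function `|sin (⟨α, h⟩ / 2)|` on `T`. -/
def absSin (P : RootPairing ι ℝ M V) [P.IsCrystallographic] (i : ι) : Torus P → ℝ :=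
  descend P (fun h => |Real.sin (P.toLinearMap (P.root i) h / 2)|) fun v l hl => by
    obtain ⟨n, hn⟩ := weight_periodLattice P (root_mem_weightLattice P i) hl
    have : P.toLinearMap (P.root i) (v + l) / 2
        = P.toLinearMap (P.root i) v / 2 + n * Real.pi := by
      rw [map_add, hn]; ring
    rw [this, Real.sin_add_int_mul_pi, abs_mul]
    simp

/-- `|α|²`, for the norm on `𝔥_ℝ^*` dual to the norm of `𝔥_ℝ`. -/
def rootNormSq (P : RootPairing ι ℝ M V) (i : ι) : ℝ :=
  ‖LinearMap.toContinuousLinearMap (P.toLinearMap (P.root i))‖ ^ 2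

open scoped Classical in
/-- The set `R_+` of positive roots with respect to a base. -/
def positiveRoots (P : RootPairing ι ℝ M V) [P.IsCrystallographic] [P.IsReduced]
    (b : P.Base) : Finset ι :=
  Finset.univ.filter fun i => b.IsPos i

/-- The potential
`∑_{α ∈ R_+} k_α (k_α - 1) |α|² (1 / (4 sin² (⟨α, h⟩ / 2)) - 1 / 12)`. It is defined off the
(null) union of the zero sets of the sines. -/
def potential (P : RootPairing ι ℝ M V) [P.IsCrystallographic] [P.IsReduced]
    (b : P.Base) (k : ι → ℝ) (t : Torus P) : ℝ :=
  ∑ i ∈ positiveRoots P b,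
    k i * (k i - 1) * rootNormSq P i * (1 / (4 * absSin P i t ^ 2) - 1 / 12)

/-- The ground state `Δ = ∏_{α ∈ R_+} |sin (⟨α, h⟩ / 2)| ^ k_α`. -/
def groundState (P : RootPairing ι ℝ M V) [P.IsCrystallographic] [P.IsReduced]
    (b : P.Base) (k : ι → ℝ) (t : Torus P) : ℝ :=
  ∏ i ∈ positiveRoots P b, absSin P i t ^ k i

/-- The graph of the trigonometric Hamiltonian in `L²(T, dμ)^W`: the pairs `(F, -ΔF + V F)` with
`F ∈ C²(T)^W` and `V F ∈ L²`. If the inner product and `k` are `W`-invariant, then `-ΔF + V F` is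
automatically `W`-invariant, so that membership of the second component in `L²(T, dμ)^W` is no
restriction on `F`. -/
def hamiltonianGraph (P : RootPairing ι ℝ M V) [P.IsRootSystem] [P.IsCrystallographic]
    [P.IsReduced] (b : P.Base) (k : ι → ℝ) : Submodule ℂ (L2W P × L2W P) where
  carrier := {p | ∃ F : Torus P → ℂ, IsC2 P F ∧ IsWeylInvariant P F ∧
    MemLp (fun t => (potential P b k t : ℂ) * F t) 2 (haarT P) ∧
    ((p.1 : Lp ℂ 2 (haarT P)) : Torus P → ℂ) =ᵐ[haarT P] F ∧
    ((p.2 : Lp ℂ 2 (haarT P)) : Torus P → ℂ) =ᵐ[haarT P]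
      fun t => -laplacianT P F t + (potential P b k t : ℂ) * F t}
  add_mem' := by
    rintro p q ⟨F, hF, hFW, hFV, hF1, hF2⟩ ⟨G, hG, hGW, hGV, hG1, hG2⟩
    refine ⟨F + G, ContDiff.add hF hG, fun w t => ?_, ?_, ?_, ?_⟩
    · simp only [Pi.add_apply, hFW w t, hGW w t]
    · convert! hFV.add hGV using 1
      ext t
      simp only [Pi.add_apply]
      ring
    · exact (Lp.coeFn_add _ _).trans (hF1.add hG1)
    · refine (Lp.coeFn_add _ _).trans ((hF2.add hG2).trans (Eventually.of_forall fun t => ?_))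
      have h := ContDiffAt.laplacian_add (x := (0 : V)) (hF.translate t).contDiffAt
        (hG.translate t).contDiffAt
      have h' : laplacianT P (F + G) t = laplacianT P F t + laplacianT P G t := h
      simp only [Pi.add_apply, h']
      ring
  zero_mem' := by
    refine ⟨0, contDiff_const, fun w t => rfl, ?_, ?_, ?_⟩
    · simp
    · exact Lp.coeFn_zero _ _ _
    · refine (Lp.coeFn_zero _ _ _).trans (Eventually.of_forall fun t => ?_)
      have h : laplacianT P (0 : Torus P → ℂ) t = 0 :=
        congrFun (InnerProductSpace.laplacian_const (E := V) (c := (0 : ℂ))) 0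
      simp [h]
  smul_mem' := by
    rintro c p ⟨F, hF, hFW, hFV, hF1, hF2⟩
    refine ⟨c • F, ContDiff.const_smul c hF, fun w t => ?_, ?_, ?_, ?_⟩
    · simp only [Pi.smul_apply, hFW w t]
    · convert! hFV.const_smul c using 1
      ext t
      simp only [Pi.smul_apply, smul_eq_mul]
      ring
    · exact (Lp.coeFn_smul _ _).trans (hF1.const_smul c)
    · refine (Lp.coeFn_smul _ _).trans
        ((hF2.const_smul c).trans (Eventually.of_forall fun t => ?_))
      have h := InnerProductSpace.laplacian_smul (x := (0 : V)) c (hF.translate t).contDiffAt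
      have h' : laplacianT P (c • F) t = c * laplacianT P F t := h
      simp only [Pi.smul_apply, smul_eq_mul, h']
      ring

/-- The graph is single-valued, since a continuous function on `T` that vanishes almost everywhere
is zero. -/
lemma hamiltonianGraph_single_valued (P : RootPairing ι ℝ M V) [P.IsRootSystem]
    [P.IsCrystallographic] [P.IsReduced] (b : P.Base) (k : ι → ℝ) :
    ∀ x ∈ hamiltonianGraph P b k, x.1 = 0 → x.2 = 0 := by
  rintro p ⟨F, hF, -, -, hF1, hF2⟩ h0
  have hF0 : F = 0 := by
    have h : F =ᵐ[haarT P] (0 : Torus P → ℂ) := by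
      rw [h0] at hF1
      exact hF1.symm.trans (Lp.coeFn_zero _ _ _)
    exact hF.continuous.ae_eq_iff_eq (haarT P) continuous_const |>.1 h
  have h : ∀ t, laplacianT P (0 : Torus P → ℂ) t = 0 := fun t =>
    congrFun (InnerProductSpace.laplacian_const (E := V) (c := (0 : ℂ))) 0
  apply Subtype.ext
  apply Lp.ext
  refine hF2.trans (EventuallyEq.trans (Eventually.of_forall fun t => ?_)
    (Lp.coeFn_zero _ _ _).symm)
  simp [hF0, h]

/-- The trigonometric Hamiltonian `H_T = -Δ + V` in `L²(T, dμ)^W`, with domain `C²(T)^W ∩ D(V)`,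
where `D(V)` is the domain of the operator of multiplication by `V`. -/
def hamiltonian (P : RootPairing ι ℝ M V) [P.IsRootSystem] [P.IsCrystallographic]
    [P.IsReduced] (b : P.Base) (k : ι → ℝ) : L2W P →ₗ.[ℂ] L2W P :=
  (hamiltonianGraph P b k).toLinearPMap

/-- The graph of the operator `hamiltonian` is `hamiltonianGraph`. -/
lemma hamiltonian_graph (P : RootPairing ι ℝ M V) [P.IsRootSystem] [P.IsCrystallographic]
    [P.IsReduced] (b : P.Base) (k : ι → ℝ) :
    (hamiltonian P b k).graph = hamiltonianGraph P b k :=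
  Submodule.toLinearPMap_graph_eq _ (hamiltonianGraph_single_valued P b k)

/-- The subspace `ℂ[P]^W · Δ` of `L²(T, dμ)^W`. -/
def jacobiDomain (P : RootPairing ι ℝ M V) [P.IsRootSystem] [P.IsCrystallographic]
    [P.IsReduced] (b : P.Base) (k : ι → ℝ) : Submodule ℂ (L2W P) where
  carrier := {f | ∃ q ∈ trigPolynomials P, IsWeylInvariant P q ∧
    ((f : Lp ℂ 2 (haarT P)) : Torus P → ℂ) =ᵐ[haarT P] fun t => q t * (groundState P b k t : ℂ)}
  add_mem' := by
    rintro f g ⟨q, hq, hqW, hf⟩ ⟨r, hr, hrW, hg⟩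
    refine ⟨q + r, add_mem hq hr, fun w t => ?_, ?_⟩
    · simp only [Pi.add_apply, hqW w t, hrW w t]
    · refine (Lp.coeFn_add _ _).trans ((hf.add hg).trans (Eventually.of_forall fun t => ?_))
      simp only [Pi.add_apply]
      ring
  zero_mem' := ⟨0, zero_mem _, fun w t => rfl, (Lp.coeFn_zero _ _ _).trans
    (Eventually.of_forall fun t => by simp)⟩
  smul_mem' := by
    rintro c f ⟨q, hq, hqW, hf⟩
    refine ⟨c • q, Submodule.smul_mem _ c hq, fun w t => ?_, ?_⟩
    · simp only [Pi.smul_apply, hqW w t]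
    · refine (Lp.coeFn_smul _ _).trans
        ((hf.const_smul c).trans (Eventually.of_forall fun t => ?_))
      simp only [Pi.smul_apply, smul_eq_mul]
      ring

end Operators

/-- An operator `A` in a Hilbert space is essentially self-adjoint if it is densely defined and
symmetric and its closure is self-adjoint. -/
def IsEssentiallySelfAdjoint {H : Type*} [NormedAddCommGroup H] [InnerProductSpace ℂ H]
    [CompleteSpace H] (A : H →ₗ.[ℂ] H) : Prop :=
  Dense (A.domain : Set H) ∧ A.IsFormalAdjoint A ∧ IsSelfAdjoint A.closure

end CalogeroSutherland

end

noncomputable section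
namespace CalogeroSutherland

section Abstract

variable {H : Type*} [NormedAddCommGroup H] [InnerProductSpace ℂ H]

lemma norm_le_norm_add_smul_of_symmetric {A : H →ₗ.[ℂ] H} (hs : A.IsFormalAdjoint A) {c : ℂ}
    (hc : c.im = 1 ∨ c.im = -1) (hre : c.re = 0) (y : A.domain) :
    ‖(y : H)‖ ≤ ‖A y + c • (y : H)‖ := by
  have him : (⟪(y : H), A y⟫_ℂ).im = 0 := by
    have h := hs y y
    rw [← inner_conj_symm] at h
    have := congrArg Complex.im h
    simp only [Complex.conj_im] at this
    linarith
  have h1 : (⟪(y : H), A y + c • (y : H)⟫_ℂ).im = c.im * ‖(y : H)‖ ^ 2 := by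
    rw [inner_add_right, inner_smul_right, inner_self_eq_norm_sq_to_K, Complex.add_im, him]
    norm_cast
    simp [Complex.mul_im, hre, -Complex.ofReal_pow]
  have h2 : ‖(y : H)‖ ^ 2 ≤ ‖(y : H)‖ * ‖A y + c • (y : H)‖ := by
    calc ‖(y : H)‖ ^ 2 = |c.im * ‖(y : H)‖ ^ 2| := by
          rw [abs_mul, abs_of_nonneg (sq_nonneg ‖(y : H)‖)]
          rcases hc with h | h <;> simp [h]
      _ ≤ ‖⟪(y : H), A y + c • (y : H)⟫_ℂ‖ := by rw [← h1]; exact Complex.abs_im_le_norm _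
      _ ≤ _ := norm_inner_le_norm _ _
  rcases (norm_nonneg (y : H)).eq_or_lt with h | h
  · rw [← h]; exact norm_nonneg _
  · rw [sq] at h2; exact le_of_mul_le_mul_left h2 h

lemma exists_add_smul_eq_of_locally_finite {A : H →ₗ.[ℂ] H} (hs : A.IsFormalAdjoint A)
    (hfin : ∀ x : A.domain, ∃ F : Submodule ℂ H, FiniteDimensional ℂ F ∧ F ≤ A.domain ∧
      (x : H) ∈ F ∧ ∀ y : A.domain, (y : H) ∈ F → A y ∈ F) {c : ℂ}
    (hc : c.im = 1 ∨ c.im = -1) (hre : c.re = 0) (p : A.domain) :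
    ∃ x : A.domain, A x + c • (x : H) = p := by
  obtain ⟨F, hF, hle, hp, hA⟩ := hfin p
  let T : F →ₗ[ℂ] F := ((A.toFun ∘ₗ Submodule.inclusion hle).codRestrict F
    fun y => hA _ y.2) + c • LinearMap.id
  have hT : ∀ y : F, (T y : H) = A (Submodule.inclusion hle y) + c • (y : H) := fun y => rfl
  have hinj : Function.Injective T := by
    rw [← LinearMap.ker_eq_bot, LinearMap.ker_eq_bot']
    intro y hy
    have h := norm_le_norm_add_smul_of_symmetric hs hc hre (Submodule.inclusion hle y)
    have h0 := hT y
    rw [hy] at h0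
    rw [Submodule.coe_inclusion, ← h0, Submodule.coe_zero, norm_zero] at h
    exact Subtype.ext (norm_le_zero_iff.1 h)
  obtain ⟨x, hx⟩ := LinearMap.surjective_of_injective hinj ⟨p, hp⟩
  exact ⟨Submodule.inclusion hle x, (hT x).symm.trans (congrArg Subtype.val hx)⟩

theorem isEssentiallySelfAdjoint_of_locally_finite [CompleteSpace H] {A : H →ₗ.[ℂ] H}
    (hd : Dense (A.domain : Set H)) (hs : A.IsFormalAdjoint A)
    (hfin : ∀ x : A.domain, ∃ F : Submodule ℂ H, FiniteDimensional ℂ F ∧ F ≤ A.domain ∧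
      (x : H) ∈ F ∧ ∀ y : A.domain, (y : H) ∈ F → A y ∈ F) :
    IsEssentiallySelfAdjoint A := by
  refine ⟨hd, hs, ?_⟩
  have hcl : A.IsClosable :=
    (LinearPMap.adjoint_isClosed hd).isClosable.leIsClosable (hs.le_adjoint hd)
  have hG : A.closure.graph = A.graph.topologicalClosure :=
    hcl.graph_closure_eq_closure_graph.symm
  have hd' : Dense (A.closure.domain : Set H) := hd.mono A.le_closure.1
  rw [LinearPMap.isSelfAdjoint_def]
  apply LinearPMap.eq_of_eq_graph
  rw [LinearPMap.adjoint_graph_eq_graph_adjoint hd', hG]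
  have hsym : ∀ p ∈ A.graph.topologicalClosure, ∀ r ∈ A.graph.topologicalClosure,
      ⟪r.2, p.1⟫_ℂ = ⟪r.1, p.2⟫_ℂ := by
    have h0 : ∀ p ∈ A.graph, ∀ r ∈ A.graph, ⟪r.2, p.1⟫_ℂ = ⟪r.1, p.2⟫_ℂ := by
      intro p hp r hr
      rw [LinearPMap.mem_graph_iff] at hp hr
      obtain ⟨y, hy1, hy2⟩ := hp
      obtain ⟨x, hx1, hx2⟩ := hr
      rw [← hy1, ← hy2, ← hx1, ← hx2]
      exact hs x y
    have h1 : ∀ p ∈ A.graph, ∀ r ∈ A.graph.topologicalClosure,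
        ⟪r.2, p.1⟫_ℂ = ⟪r.1, p.2⟫_ℂ := fun p hp r hr =>
      closure_minimal (s := (A.graph : Set (H × H)))
        (t := {r | ⟪r.2, p.1⟫_ℂ = ⟪r.1, p.2⟫_ℂ}) (fun r hr => h0 p hp r hr)
        (isClosed_eq (by fun_prop) (by fun_prop)) hr
    exact fun p hp r hr =>
      closure_minimal (s := (A.graph : Set (H × H)))
        (t := {p | ⟪r.2, p.1⟫_ℂ = ⟪r.1, p.2⟫_ℂ}) (fun p hp => h1 p hp r hr)
        (isClosed_eq (by fun_prop) (by fun_prop)) hp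
  ext ⟨x, y⟩
  rw [Submodule.mem_adjoint_iff]
  refine ⟨fun hxy => ?_, fun hxy a b' hab => sub_eq_zero.2 (hsym _ hxy _ hab)⟩
  obtain ⟨p, hp, hlim⟩ := mem_closure_iff_seq_limit.1 (hd (y + Complex.I • x))
  choose a ha using fun n =>
    exists_add_smul_eq_of_locally_finite hs hfin (c := Complex.I) (by simp) (by simp) ⟨p n, hp n⟩
  have hle : ∀ m n, dist (a m : H) (a n) ≤ dist (p m) (p n) := fun m n => by
    rw [dist_eq_norm, dist_eq_norm]
    have h := norm_le_norm_add_smul_of_symmetric hs (c := Complex.I) (by simp) (by simp)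
      (a m - a n)
    rw [LinearPMap.map_sub, Submodule.coe_sub] at h
    refine h.trans_eq (congrArg _ ?_)
    have hm := ha m
    have hn := ha n
    simp only at hm hn
    rw [← hm, ← hn, smul_sub]
    abel
  have hcau : CauchySeq fun n => (a n : H) := by
    rw [Metric.cauchySeq_iff]
    intro ε hε
    obtain ⟨N, hN⟩ := Metric.cauchySeq_iff.1 hlim.cauchySeq ε hε
    exact ⟨N, fun m hm n hn => (hle m n).trans_lt (hN m hm n hn)⟩
  obtain ⟨z, hz⟩ := cauchySeq_tendsto_of_complete hcau
  have hAa : Tendsto (fun n => A (a n)) atTop (𝓝 (y + Complex.I • x - Complex.I • z)) := by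
    have : (fun n => A (a n)) = fun n => p n - Complex.I • (a n : H) :=
      funext fun n => eq_sub_of_add_eq (ha n)
    rw [this]
    exact hlim.sub (hz.const_smul _)
  have hmem : (z, y + Complex.I • x - Complex.I • z) ∈ A.graph.topologicalClosure :=
    mem_closure_of_tendsto (hz.prodMk_nhds hAa) (Eventually.of_forall fun n => A.mem_graph (a n))
  have hzero : x - z = 0 := by
    refine hd.eq_zero_of_inner_right ℂ fun q hq => ?_
    obtain ⟨c, hc⟩ := exists_add_smul_eq_of_locally_finite hs hfin (c := -Complex.I) (by simp)
      (by simp) ⟨q, hq⟩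
    have hcg : ((c : H), A c) ∈ A.graph.topologicalClosure := subset_closure (A.mem_graph c)
    have e1 := sub_eq_zero.1 (hxy _ _ hcg)
    have e2 := hsym _ hmem _ hcg
    simp only [inner_sub_right, inner_add_right, inner_smul_right] at e1 e2
    simp only at hc
    rw [← hc, inner_add_left, inner_smul_left, inner_sub_right, inner_sub_right, e1, e2]
    simp
    ring
  rw [sub_eq_zero] at hzero
  subst hzero
  simpa using hmem

end Abstract
section PowerFunctions

lemma hasDerivAt_abs_rpow_mul_self {q : ℝ} (hq : 0 < q) (x : ℝ) :
    HasDerivAt (fun x : ℝ => |x| ^ q * x) ((q + 1) * |x| ^ q) x := by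
  rcases eq_or_ne x 0 with rfl | hx
  · rw [hasDerivAt_iff_tendsto_slope]
    have h : Tendsto (fun x : ℝ => |x| ^ q) (𝓝[≠] 0) (𝓝 ((q + 1) * |(0 : ℝ)| ^ q)) := by
      have hc : ContinuousAt (fun x : ℝ => |x| ^ q) 0 :=
        continuous_abs.continuousAt.rpow_const (Or.inr hq.le)
      have := hc.tendsto.mono_left (nhdsWithin_le_nhds (s := {0}ᶜ))
      simpa [Real.zero_rpow hq.ne'] using this
    refine h.congr' ?_
    filter_upwards [self_mem_nhdsWithin] with y hy
    have hy : y ≠ 0 := hy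
    simp [slope_def_field, Real.zero_rpow hq.ne', hy]
  · have h := ((hasDerivAt_abs hx).rpow_const (p := q) (Or.inl (abs_ne_zero.2 hx))).mul
      (hasDerivAt_id x)
    refine h.congr_deriv ?_
    have h1 : |x| ^ q = |x| ^ (q - 1) * |x| := by
      rw [← Real.rpow_add_one (abs_ne_zero.2 hx), sub_add_cancel]
    have h2 : (SignType.sign x : ℝ) * x = |x| := by simp
    simp only [id]
    rw [h1, mul_one]
    linear_combination q * |x| ^ (q - 1) * h2

lemma contDiff_two_abs_rpow {p : ℝ} (hp : 2 ≤ p) : ContDiff ℝ 2 fun x : ℝ => |x| ^ p := by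
  have h1 : ∀ x, HasDerivAt (fun x : ℝ => |x| ^ p) (p * |x| ^ (p - 2) * x) x := fun x =>
    hasDerivAt_abs_rpow x (by linarith)
  have hd : deriv (fun x : ℝ => |x| ^ p) = fun x => p * (|x| ^ (p - 2) * x) :=
    funext fun x => by rw [(h1 x).deriv, mul_assoc]
  rw [show (2 : WithTop ℕ∞) = 1 + 1 by norm_num, contDiff_succ_iff_deriv]
  refine ⟨fun x => (h1 x).differentiableAt, by simp, ?_⟩
  rw [hd]
  refine contDiff_const.mul ?_
  rcases hp.eq_or_lt with rfl | hp
  · simp only [sub_self, Real.rpow_zero, one_mul]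
    exact contDiff_id
  · have h2 := fun x => hasDerivAt_abs_rpow_mul_self (q := p - 2) (by linarith) x
    rw [contDiff_one_iff_deriv]
    refine ⟨fun x => (h2 x).differentiableAt, ?_⟩
    rw [funext fun x => (h2 x).deriv]
    exact continuous_const.mul (continuous_abs.rpow_const fun x => Or.inr (by linarith))

lemma hasDerivAt_abs_sin_rpow (p : ℝ) {x : ℝ} (hx : Real.sin x ≠ 0) :
    HasDerivAt (fun x => |Real.sin x| ^ p) (p * Real.cot x * |Real.sin x| ^ p) x := by
  have h := ((hasDerivAt_abs hx).comp x (Real.hasDerivAt_sin x)).rpow_const (p := p)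
    (Or.inl (abs_ne_zero.2 hx))
  refine h.congr_deriv ?_
  have h1 : |Real.sin x| ^ p = |Real.sin x| ^ (p - 1) * |Real.sin x| := by
    rw [← Real.rpow_add_one (abs_ne_zero.2 hx), sub_add_cancel]
  have h2 : (SignType.sign (Real.sin x) : ℝ) * Real.sin x = |Real.sin x| := by simp
  simp only [Function.comp]
  rw [h1, ← h2, Real.cot_eq_cos_div_sin]
  field_simp

lemma hasDerivAt_cot {x : ℝ} (hx : Real.sin x ≠ 0) :
    HasDerivAt Real.cot (-(1 / Real.sin x ^ 2)) x := by
  have h := (Real.hasDerivAt_cos x).div (Real.hasDerivAt_sin x) hx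
  have h' : Real.cot = fun x => Real.cos x / Real.sin x := funext Real.cot_eq_cos_div_sin
  rw [h']
  refine h.congr_deriv ?_
  field_simp
  linear_combination -Real.sin_sq_add_cos_sq x

end PowerFunctions
section PartialFractions

open Polynomial in
/-- If a sum of products of pairs of functions `(X ^ p + a) / (X ^ p - a)` has no poles, it is
constant. The denominators are cleared, and the sum is evaluated at `1`. -/
lemma sum_sum_eq_of_residues_eq_zero {ι : Type*} [DecidableEq ι] (s : Finset ι) (p : ι → ℕ)
    (hp : ∀ i ∈ s, p i ≠ 0) (a : ι → ℂ) (ha : ∀ i ∈ s, a i ≠ 0) (c : ι → ι → ℂ)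
    (hc : ∀ i j, c i j = c j i)
    (hgen : ∀ i ∈ s, ∀ j ∈ s, i ≠ j → ∀ w : ℂ, w ^ p i = a i → w ^ p j ≠ a j)
    (hres : ∀ i ∈ s, ∀ w : ℂ, w ^ p i = a i →
      ∑ j ∈ s.erase i, c i j * ((w ^ p j + a j) / (w ^ p j - a j)) = 0) :
    ∑ i ∈ s, ∑ j ∈ s.erase i, c i j * ((1 + a i) * (1 + a j)) *
        ∏ l ∈ (s.erase i).erase j, (1 - a l)
      = (∑ i ∈ s, ∑ j ∈ s.erase i, c i j) * ∏ l ∈ s, (1 - a l) := by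
  set T : ι → ι → ℂ[X] := fun i j => C (c i j) * ((X ^ p i + C (a i)) * (X ^ p j + C (a j))) *
    ∏ l ∈ (s.erase i).erase j, (X ^ p l - C (a l)) with hT
  set N : ℂ[X] := ∑ i ∈ s, ∑ j ∈ s.erase i, T i j with hN
  set D : ℂ[X] := ∏ l ∈ s, (X ^ p l - C (a l)) with hD
  have hTsymm : ∀ i j, T i j = T j i := fun i j => by
    simp only [hT]
    rw [hc, Finset.erase_right_comm, mul_comm (X ^ p i + C (a i))]
  have hTe : ∀ i j (w : ℂ), (T i j).eval w = c i j * ((w ^ p i + a i) * (w ^ p j + a j)) *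
      ∏ l ∈ (s.erase i).erase j, (w ^ p l - a l) := fun i j w => by
    simp [hT, eval_prod]
  have hmonic : ∀ l ∈ s, (X ^ p l - C (a l)).Monic := fun l hl => monic_X_pow_sub_C _ (hp l hl)
  have hTl : ∀ l ∈ s, ∀ w : ℂ, w ^ p l = a l → ∑ j ∈ s.erase l, (T l j).eval w = 0 := by
    intro l hl w hw
    have : ∑ j ∈ s.erase l, (T l j).eval w = (w ^ p l + a l) *
        (∏ m ∈ s.erase l, (w ^ p m - a m)) *
        ∑ j ∈ s.erase l, c l j * ((w ^ p j + a j) / (w ^ p j - a j)) := by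
      rw [Finset.mul_sum]
      refine Finset.sum_congr rfl fun j hj => ?_
      have hne : w ^ p j - a j ≠ 0 := sub_ne_zero.2
        (hgen l hl j (Finset.mem_of_mem_erase hj) (Finset.ne_of_mem_erase hj).symm w hw)
      rw [hTe, ← Finset.mul_prod_erase _ _ hj]
      field_simp
    rw [this, hres l hl w hw, mul_zero]
  have hNroot : ∀ l ∈ s, ∀ w : ℂ, w ^ p l = a l → N.eval w = 0 := by
    intro l hl w hw
    have hvan : ∀ i ∈ s.erase l, ∑ j ∈ s.erase i, (T i j).eval w = (T l i).eval w := by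
      intro i hi
      have hli : l ∈ s.erase i := Finset.mem_erase.2 ⟨(Finset.ne_of_mem_erase hi).symm, hl⟩
      rw [hTsymm l i]
      refine Finset.sum_eq_single_of_mem l hli fun j hj hjl => ?_
      rw [hTe, Finset.prod_eq_zero (Finset.mem_erase.2 ⟨hjl.symm, hli⟩) (by rw [hw, sub_self]),
        mul_zero]
    rw [hN, eval_finsetSum]
    simp only [eval_finsetSum]
    rw [← Finset.add_sum_erase _ _ hl, Finset.sum_congr rfl hvan, hTl l hl w hw, add_zero]
  have hdvd : ∀ l ∈ s, X ^ p l - C (a l) ∣ N := by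
    intro l hl
    rcases eq_or_ne N 0 with h0 | h0
    · rw [h0]; exact dvd_zero _
    · rw [IsAlgClosed.dvd_iff_roots_le_roots (hmonic l hl).ne_zero h0,
        Multiset.le_iff_subset (nodup_roots (separable_X_pow_sub_C (a l)
          (by exact_mod_cast hp l hl) (ha l hl)))]
      intro w hw
      rw [mem_roots (hmonic l hl).ne_zero, IsRoot, eval_sub, eval_pow, eval_X, eval_C,
        sub_eq_zero] at hw
      exact (mem_roots h0).2 (hNroot l hl w hw)
  have hcop : (s : Set ι).Pairwise (Function.onFun IsCoprime fun l => X ^ p l - C (a l)) := by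
    intro i hi j hj hij
    simp only [Function.onFun]
    rw [isCoprime_iff_aeval_ne_zero_of_isAlgClosed ℂ ℂ]
    intro w
    by_cases hw : w ^ p i = a i
    · right
      simpa [sub_eq_zero] using hgen i hi j hj hij w hw
    · left
      simpa [sub_eq_zero] using hw
  obtain ⟨Q, hQ⟩ : D ∣ N := Finset.prod_dvd_of_coprime hcop hdvd
  have hDm : D.Monic := monic_prod_of_monic _ _ hmonic
  have hDdeg : D.natDegree = ∑ l ∈ s, p l := by
    rw [hD, natDegree_prod_of_monic _ _ hmonic]
    simp
  have hNdeg : N.natDegree ≤ ∑ l ∈ s, p l := by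
    refine natDegree_sum_le_of_forall_le _ _ fun i hi =>
      natDegree_sum_le_of_forall_le _ _ fun j hj => ?_
    rw [← Finset.add_sum_erase _ _ hi, ← Finset.add_sum_erase _ _ hj, ← add_assoc]
    refine natDegree_mul_le_of_le ((natDegree_C_mul_le _ _).trans (natDegree_mul_le_of_le ?_ ?_)) ?_
    · simp
    · simp
    · refine (natDegree_prod_le _ _).trans (Finset.sum_le_sum fun l _ => ?_)
      simp
  have hQdeg : Q.natDegree = 0 := by
    rcases eq_or_ne Q 0 with h0 | h0
    · simp [h0]
    · have := hDm.natDegree_mul' h0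
      rw [← hQ, hDdeg] at this
      omega
  obtain ⟨q, rfl⟩ : ∃ q, Q = C q := ⟨_, eq_C_of_natDegree_eq_zero hQdeg⟩
  have hev : ∀ w : ℂ, N.eval w = (∏ l ∈ s, (w ^ p l - a l)) * q := fun w => by
    rw [hQ, eval_mul, eval_C, hD, eval_prod]
    simp
  have hNe : ∀ w : ℂ, N.eval w = ∑ i ∈ s, ∑ j ∈ s.erase i,
      c i j * ((w ^ p i + a i) * (w ^ p j + a j)) *
        ∏ l ∈ (s.erase i).erase j, (w ^ p l - a l) := fun w => by
    rw [hN, eval_finsetSum]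
    simp only [eval_finsetSum, hTe]
  have h0 : N.eval 0 = (∑ i ∈ s, ∑ j ∈ s.erase i, c i j) * ∏ l ∈ s, (0 - a l) := by
    rw [hNe, Finset.sum_mul]
    refine Finset.sum_congr rfl fun i hi => ?_
    rw [Finset.sum_mul]
    refine Finset.sum_congr rfl fun j hj => ?_
    have hj' := Finset.mem_of_mem_erase hj
    rw [← Finset.mul_prod_erase _ _ hi, ← Finset.mul_prod_erase _ _ hj,
      zero_pow (hp i hi), zero_pow (hp j hj')]
    have : ∏ l ∈ (s.erase i).erase j, ((0 : ℂ) ^ p l - a l)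
        = ∏ l ∈ (s.erase i).erase j, (0 - a l) := by
      refine Finset.prod_congr rfl fun l hl => ?_
      rw [zero_pow (hp l (Finset.mem_of_mem_erase (Finset.mem_of_mem_erase hl)))]
    rw [this]
    ring
  have hq : q = ∑ i ∈ s, ∑ j ∈ s.erase i, c i j := by
    have h1 := hev 0
    have h2 : ∏ l ∈ s, ((0 : ℂ) ^ p l - a l) = ∏ l ∈ s, (0 - a l) :=
      Finset.prod_congr rfl fun l hl => by rw [zero_pow (hp l hl)]
    have h3 : ∏ l ∈ s, (0 - a l) ≠ 0 := Finset.prod_ne_zero_iff.2 fun l hl => by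
      simpa using ha l hl
    rw [h0, h2, mul_comm] at h1
    exact (mul_left_cancel₀ h3 h1).symm
  have h1 := hNe 1
  rw [hev] at h1
  simp only [one_pow] at h1
  rw [← h1, hq, mul_comm]

end PartialFractions
section RootForm

variable {ι M V : Type*} [AddCommGroup M] [Module ℝ M]
  [NormedAddCommGroup V] [InnerProductSpace ℝ V] [FiniteDimensional ℝ V]

/-- The vector of `𝔥_ℝ` that represents `x ∈ 𝔥_ℝ^*` through the inner product. -/
def dualVec (P : RootPairing ι ℝ M V) (x : M) : V :=
  haveI := FiniteDimensional.complete ℝ V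
  (InnerProductSpace.toDual ℝ V).symm (LinearMap.toContinuousLinearMap (P.toLinearMap x))

lemma inner_dualVec (P : RootPairing ι ℝ M V) (x : M) (h : V) :
    ⟪dualVec P x, h⟫_ℝ = P.toLinearMap x h := by
  have := FiniteDimensional.complete ℝ V
  simp [dualVec, InnerProductSpace.toDual_symm_apply]

/-- The inner product on `𝔥_ℝ^*` dual to the inner product of `𝔥_ℝ`. -/
def dualForm (P : RootPairing ι ℝ M V) (x y : M) : ℝ := ⟪dualVec P x, dualVec P y⟫_ℝ

lemma dualForm_comm (P : RootPairing ι ℝ M V) (x y : M) : dualForm P x y = dualForm P y x :=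
  real_inner_comm _ _

lemma dualVec_add (P : RootPairing ι ℝ M V) (x y : M) :
    dualVec P (x + y) = dualVec P x + dualVec P y := by
  refine ext_inner_right ℝ fun h => ?_
  simp [inner_dualVec, inner_add_left]

lemma dualVec_smul (P : RootPairing ι ℝ M V) (c : ℝ) (x : M) :
    dualVec P (c • x) = c • dualVec P x := by
  refine ext_inner_right ℝ fun h => ?_
  simp [inner_dualVec, inner_smul_left]

lemma dualVec_neg (P : RootPairing ι ℝ M V) (x : M) : dualVec P (-x) = -dualVec P x := by
  rw [← neg_one_smul ℝ, dualVec_smul, neg_one_smul]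

lemma rootNormSq_eq_dualForm (P : RootPairing ι ℝ M V) (i : ι) :
    rootNormSq P i = dualForm P (P.root i) (P.root i) := by
  have := FiniteDimensional.complete ℝ V
  rw [rootNormSq, dualForm, real_inner_self_eq_norm_sq, dualVec, LinearIsometryEquiv.norm_map]

/-- Parseval's identity for the dual inner product. -/
lemma sum_mul_eq_dualForm (P : RootPairing ι ℝ M V) {κ : Type*} [Fintype κ]
    (e : OrthonormalBasis κ ℝ V) (x y : M) :
    ∑ j, P.toLinearMap x (e j) * P.toLinearMap y (e j) = dualForm P x y := by
  rw [dualForm, ← e.sum_inner_mul_inner]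
  refine Finset.sum_congr rfl fun j _ => ?_
  rw [inner_dualVec, real_inner_comm, inner_dualVec]

lemma toLinearMap_root_reflectionPerm (P : RootPairing ι ℝ M V) (i j : ι) (h : V) :
    P.toLinearMap (P.root (P.reflectionPerm i j)) h
      = P.toLinearMap (P.root j) (P.coreflection i h) := by
  rw [← P.reflectionPerm_root, P.coreflection_apply]
  simp [mul_comm]

lemma toLinearMap_reflection (P : RootPairing ι ℝ M V) (i : ι) (x : M) (h : V) :
    P.toLinearMap (P.reflection i x) h = P.toLinearMap x (P.coreflection i h) := by
  rw [P.reflection_apply, P.coreflection_apply]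
  simp [mul_comm]

lemma root_reflectionPerm_self (P : RootPairing ι ℝ M V) (i : ι) :
    P.root (P.reflectionPerm i i) = -P.root i := by
  rw [P.root_reflectionPerm, P.reflection_apply_self]

lemma toLinearMap_root_reflectionPerm_eq_sub (P : RootPairing ι ℝ M V) [P.IsCrystallographic]
    (i j : ι) : ∃ n : ℤ, ∀ h, P.toLinearMap (P.root (P.reflectionPerm i j)) h
      = P.toLinearMap (P.root j) h - n * P.toLinearMap (P.root i) h := by
  obtain ⟨n, hn⟩ := P.exists_value (S := ℤ) j i
  refine ⟨n, fun h => ?_⟩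
  have hn' : P.toLinearMap (P.root j) (P.coroot i) = n := hn.symm
  rw [← P.reflectionPerm_root, hn']
  simp

lemma coreflection_mem_weylGroup (P : RootPairing ι ℝ M V) (i : ι) :
    P.coreflection i ∈ weylGroup P :=
  Subgroup.subset_closure ⟨i, rfl⟩

/-- The inner product of `𝔥_ℝ` is invariant under the Weyl group. -/
def IsInvariantInner (P : RootPairing ι ℝ M V) : Prop :=
  ∀ w ∈ weylGroup P, ∀ x y : V, ⟪w x, w y⟫_ℝ = ⟪x, y⟫_ℝ

lemma dualVec_reflection {P : RootPairing ι ℝ M V} (hinner : IsInvariantInner P) (i : ι) (x : M) :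
    dualVec P (P.reflection i x) = P.coreflection i (dualVec P x) := by
  refine ext_inner_right ℝ fun h => ?_
  rw [inner_dualVec, toLinearMap_reflection, ← inner_dualVec,
    ← hinner _ (coreflection_mem_weylGroup P i) (dualVec P x), P.coreflection_same]

lemma dualForm_reflection {P : RootPairing ι ℝ M V} (hinner : IsInvariantInner P) (i : ι)
    (x y : M) : dualForm P (P.reflection i x) (P.reflection i y) = dualForm P x y := by
  rw [dualForm, dualVec_reflection hinner, dualVec_reflection hinner,
    hinner _ (coreflection_mem_weylGroup P i)]
  rfl

lemma dualForm_neg_left (P : RootPairing ι ℝ M V) (x y : M) :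
    dualForm P (-x) y = -dualForm P x y := by
  rw [dualForm, dualVec_neg, inner_neg_left]; rfl

lemma dualForm_neg_right (P : RootPairing ι ℝ M V) (x y : M) :
    dualForm P x (-y) = -dualForm P x y := by
  rw [dualForm_comm, dualForm_neg_left, dualForm_comm]

lemma dualForm_root_reflectionPerm {P : RootPairing ι ℝ M V} (hinner : IsInvariantInner P)
    (i j : ι) : dualForm P (P.root i) (P.root (P.reflectionPerm i j))
      = -dualForm P (P.root i) (P.root j) := by
  rw [P.root_reflectionPerm, ← dualForm_reflection hinner i, P.reflection_same,
    P.reflection_apply_self, dualForm_neg_left]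

/-- `(x, α) = ⟨x, α^∨⟩ |α|² / 2`. -/
lemma two_mul_dualForm_root {P : RootPairing ι ℝ M V} (hinner : IsInvariantInner P)
    (i : ι) (x : M) : 2 * dualForm P x (P.root i)
      = P.toLinearMap x (P.coroot i) * dualForm P (P.root i) (P.root i) := by
  have h := dualForm_reflection hinner i x (P.root i)
  rw [P.reflection_apply_self, dualForm_neg_right, P.reflection_apply] at h
  have h2 : dualForm P (x - (P.coroot' i) x • P.root i) (P.root i)
      = dualForm P x (P.root i)
        - P.toLinearMap x (P.coroot i) * dualForm P (P.root i) (P.root i) := by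
    rw [dualForm, sub_eq_add_neg, ← neg_smul, dualVec_add, dualVec_smul, inner_add_left,
      inner_smul_left]
    simp [dualForm]
    ring
  rw [h2] at h
  linarith

end RootForm

section CotIdentity

variable {ι M V : Type*} [Fintype ι] [AddCommGroup M] [Module ℝ M]
  [NormedAddCommGroup V] [InnerProductSpace ℝ V] [FiniteDimensional ℝ V]
  {P : RootPairing ι ℝ M V} [P.IsRootSystem] [P.IsCrystallographic] [P.IsReduced]

lemma mem_positiveRoots {b : P.Base} {i : ι} : i ∈ positiveRoots P b ↔ 0 < b.height i := by
  simp [positiveRoots, RootPairing.Base.isPos_iff]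

@[to_additive]
lemma prod_eq_prod_positiveRoots_mul_self {A : Type*} [CommMonoid A] (b : P.Base) (f : ι → A)
    (hf : ∀ i, f (P.reflectionPerm i i) = f i) :
    ∏ i, f i = (∏ i ∈ positiveRoots P b, f i) * ∏ i ∈ positiveRoots P b, f i := by
  classical
  have hneg : ∀ i, b.height (P.reflectionPerm i i) = -b.height i :=
    fun i => b.height_reflectionPerm_self i
  have hinv : ∀ i, P.reflectionPerm (P.reflectionPerm i i) (P.reflectionPerm i i) = i := fun i => by
    apply P.root.injective
    rw [root_reflectionPerm_self, root_reflectionPerm_self, neg_neg]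
  rw [← Finset.prod_filter_mul_prod_filter_not Finset.univ (fun i => b.IsPos i) f]
  congr 1
  refine Finset.prod_nbij' (fun i => P.reflectionPerm i i) (fun i => P.reflectionPerm i i)
    ?_ ?_ (fun i _ => hinv i) (fun i _ => hinv i) (fun i _ => (hf i).symm)
  · intro i hi
    have hi' : ¬ 0 < b.height i := by simpa [RootPairing.Base.isPos_iff] using hi
    have := b.height_ne_zero i
    rw [mem_positiveRoots, hneg]
    omega
  · intro i hi
    rw [mem_positiveRoots] at hi
    have : ¬ 0 < b.height (P.reflectionPerm i i) := by rw [hneg]; omega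
    simpa [RootPairing.Base.isPos_iff] using this

/-- `k` is invariant under the Weyl group. -/
def IsInvariantMult (P : RootPairing ι ℝ M V) (k : ι → ℝ) : Prop :=
  ∀ (w : P.weylGroup) (i : ι), k (P.weylGroupToPerm w i) = k i

lemma IsInvariantMult.reflectionPerm {k : ι → ℝ} (hk : IsInvariantMult P k) (i j : ι) :
    k (P.reflectionPerm i j) = k j := by
  have h : P.reflectionPerm i ∈ P.weylGroupToPerm.range := by
    rw [P.range_weylGroupToPerm]
    exact Subgroup.subset_closure ⟨i, rfl⟩
  obtain ⟨w, hw⟩ := h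
  rw [← hw, hk w j]

lemma cot_sub_int_mul_pi (x : ℝ) (n : ℤ) : Real.cot (x - n * Real.pi) = Real.cot x := by
  rw [Real.cot_eq_cos_div_sin, Real.cot_eq_cos_div_sin, Real.sin_sub_int_mul_pi,
    Real.cos_sub_int_mul_pi, mul_div_mul_left]
  exact zpow_ne_zero _ (by norm_num)

lemma cot_neg (x : ℝ) : Real.cot (-x) = -Real.cot x := by
  rw [Real.cot_eq_cos_div_sin, Real.cot_eq_cos_div_sin, Real.cos_neg, Real.sin_neg, div_neg]

/-- The residue of `∑ k_α k_β (α, β) cot (α / 2) cot (β / 2)` along a wall vanishes. -/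
lemma sum_dualForm_mul_cot_eq_zero (hinner : IsInvariantInner P) (b : P.Base) {k : ι → ℝ}
    (hk : IsInvariantMult P k) (i : ι) {h : V} {n : ℤ}
    (hn : P.toLinearMap (P.root i) h = n * (2 * Real.pi)) :
    ∑ j ∈ positiveRoots P b, k j * dualForm P (P.root i) (P.root j)
      * Real.cot (P.toLinearMap (P.root j) h / 2) = 0 := by
  set f : ι → ℝ := fun j => k j * dualForm P (P.root i) (P.root j)
      * Real.cot (P.toLinearMap (P.root j) h / 2) with hf
  have h1 : ∑ j, f j = ∑ j ∈ positiveRoots P b, f j + ∑ j ∈ positiveRoots P b, f j := by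
    refine sum_eq_sum_positiveRoots_add_self b f fun j => ?_
    simp only [hf]
    rw [hk.reflectionPerm, root_reflectionPerm_self, dualForm_neg_right, map_neg,
      LinearMap.neg_apply, neg_div, cot_neg]
    ring
  have h2 : ∑ j, f j = -∑ j, f j := by
    rw [← Finset.sum_neg_distrib]
    refine Fintype.sum_equiv (P.reflectionPerm i) _ _ fun j => ?_
    simp only [hf]
    obtain ⟨m, hm⟩ := toLinearMap_root_reflectionPerm_eq_sub P i j
    have hc : Real.cot (P.toLinearMap (P.root (P.reflectionPerm i j)) h / 2)
        = Real.cot (P.toLinearMap (P.root j) h / 2) := by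
      rw [← cot_sub_int_mul_pi (P.toLinearMap (P.root j) h / 2) (m * n), hm, hn]
      congr 1
      push_cast
      ring
    rw [hk.reflectionPerm, dualForm_root_reflectionPerm hinner, hc]
    ring
  linarith

lemma exists_toLinearMap_root_eq_height (b : P.Base) :
    ∃ v : V, ∀ i, P.toLinearMap (P.root i) v = b.height i := by
  obtain ⟨v, hv⟩ := (LinearMap.IsPerfPair.bijective_right P.toLinearMap).2
    (b.toWeightBasis.constr ℝ fun _ => (1 : ℝ))
  refine ⟨v, fun i => ?_⟩
  obtain ⟨f, -, -, hf⟩ := b.exists_root_eq_sum_int i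
  rw [RootPairing.Base.height_eq_sum hf, hf]
  have h1 : ∀ j ∈ b.support, P.toLinearMap (P.root j) v = 1 := fun j hj => by
    have := congrArg (fun g => g (P.root j)) hv
    simp only [LinearMap.flip_apply] at this
    rw [this]
    have h2 := b.toWeightBasis.constr_basis ℝ (fun _ => (1 : ℝ)) ⟨j, hj⟩
    rwa [b.toWeightBasis_apply] at h2
  simp only [map_sum, LinearMap.sum_apply, map_zsmul, LinearMap.smul_apply]
  push_cast
  refine Finset.sum_congr rfl fun j hj => ?_
  rw [h1 j hj]
  simp

lemma exp_add_one_div_exp_sub_one (y : ℝ) :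
    (Complex.exp (Complex.I * y) + 1) / (Complex.exp (Complex.I * y) - 1)
      = -Complex.I * (Real.cot (y / 2) : ℝ) := by
  rw [Complex.ofReal_cot, Complex.cot_eq_exp_ratio]
  have : 2 * Complex.I * ((y / 2 : ℝ) : ℂ) = Complex.I * y := by push_cast; ring
  rw [this]
  rcases eq_or_ne (Complex.exp (Complex.I * y)) 1 with h | h
  · simp [h]
  · have h1 : Complex.exp (Complex.I * y) - 1 ≠ 0 := sub_ne_zero.2 h
    have h2 : 1 - Complex.exp (Complex.I * y) ≠ 0 := sub_ne_zero.2 h.symm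
    field_simp
    ring

/-- The points off the walls, such that no complex line through them in the direction of the
height function meets two walls at once, are dense. -/
lemma dense_generic (b : P.Base) : Dense {h : V | ∀ i ∈ positiveRoots P b,
    ∀ j ∈ positiveRoots P b, i ≠ j → ∀ n : ℤ,
      b.height j * P.toLinearMap (P.root i) h - b.height i * P.toLinearMap (P.root j) h
        ≠ n * (2 * Real.pi)} := by
  have := FiniteDimensional.complete ℝ V
  have hset : {h : V | ∀ i ∈ positiveRoots P b, ∀ j ∈ positiveRoots P b, i ≠ j → ∀ n : ℤ,
      b.height j * P.toLinearMap (P.root i) h - b.height i * P.toLinearMap (P.root j) h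
        ≠ n * (2 * Real.pi)} = ⋂ x : {x : ι × ι // x.1 ∈ positiveRoots P b ∧
          x.2 ∈ positiveRoots P b ∧ x.1 ≠ x.2} × ℤ, {h : V |
      (b.height x.1.1.2 * P.toLinearMap (P.root x.1.1.1) h
        - b.height x.1.1.1 * P.toLinearMap (P.root x.1.1.2) h) ≠ x.2 * (2 * Real.pi)} := by
    ext h
    simp only [Set.mem_ofPred_eq, Set.mem_iInter]
    exact ⟨fun H x => H _ x.1.2.1 _ x.1.2.2.1 x.1.2.2.2 _,
      fun H i hi j hj hij n => H (⟨(i, j), hi, hj, hij⟩, n)⟩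
  rw [hset]
  have key : ∀ x : {x : ι × ι // x.1 ∈ positiveRoots P b ∧
          x.2 ∈ positiveRoots P b ∧ x.1 ≠ x.2} × ℤ, ∃ φ : V →ₗ[ℝ] ℝ, φ ≠ 0 ∧ {h : V |
      (b.height x.1.1.2 * P.toLinearMap (P.root x.1.1.1) h
        - b.height x.1.1.1 * P.toLinearMap (P.root x.1.1.2) h) ≠ x.2 * (2 * Real.pi)}
        = φ ⁻¹' {x.2 * (2 * Real.pi)}ᶜ := by
    rintro ⟨⟨⟨i, j⟩, hi, hj, hij⟩, n⟩
    simp only at hi hj hij ⊢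
    refine ⟨P.toLinearMap ((b.height j : ℝ) • P.root i - (b.height i : ℝ) • P.root j), ?_, ?_⟩
    · intro h0
      have h1 := (LinearMap.IsPerfPair.bijective_left P.toLinearMap).1 (h0.trans (map_zero _).symm)
      have hpi := mem_positiveRoots.1 hi
      have hpj := mem_positiveRoots.1 hj
      have hlin := RootPairing.IsReduced.linearIndependent P hij (fun h => by
        have : i = P.reflectionPerm j j := P.root.injective (by
          rw [h, root_reflectionPerm_self])
        have h2 : b.height (P.reflectionPerm j j) = -b.height j := b.height_reflectionPerm_self j
        rw [← this] at h2
        omega)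
      rw [LinearIndependent.pair_iff] at hlin
      have := (hlin (b.height j) (-b.height i) (by rw [neg_smul, ← sub_eq_add_neg]; exact h1)).1
      have : b.height j = 0 := by exact_mod_cast this
      omega
    · ext h
      simp
  refine dense_iInter_of_isOpen (fun x => ?_) (fun x => ?_)
  · obtain ⟨φ, -, h⟩ := key x
    rw [h]
    exact isOpen_compl_singleton.preimage (LinearMap.continuous_of_finiteDimensional φ)
  · obtain ⟨φ, hφ, h⟩ := key x
    rw [h]
    exact (dense_compl_singleton _).preimage
      (φ.isOpenMap_of_finiteDimensional (LinearMap.surjective hφ))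

/-- `∑ k_α k_β (α, β) cot (α / 2) cot (β / 2)`, the sum over pairs of distinct positive roots,
is constant. -/
theorem sum_cot_mul_cot (hinner : IsInvariantInner P) (b : P.Base) {k : ι → ℝ}
    (hk : IsInvariantMult P k) [DecidableEq ι] {h : V}
    (hreg : ∀ i, Real.sin (P.toLinearMap (P.root i) h / 2) ≠ 0) :
    ∑ i ∈ positiveRoots P b, ∑ j ∈ (positiveRoots P b).erase i,
      k i * k j * dualForm P (P.root i) (P.root j) *
        (Real.cot (P.toLinearMap (P.root i) h / 2) * Real.cot (P.toLinearMap (P.root j) h / 2))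
      = -∑ i ∈ positiveRoots P b, ∑ j ∈ (positiveRoots P b).erase i,
        k i * k j * dualForm P (P.root i) (P.root j) := by
  set s := positiveRoots P b with hs
  set c : ι → ι → ℂ := fun i j => ((k i * k j * dualForm P (P.root i) (P.root j) : ℝ) : ℂ) with hc
  let a : V → ι → ℂ := fun h i => Complex.exp (-(Complex.I * (P.toLinearMap (P.root i) h : ℝ)))
  have hcont : ∀ i, Continuous fun h => a h i := fun i => by
    have : Continuous fun h : V => P.toLinearMap (P.root i) h :=
      LinearMap.continuous_of_finiteDimensional _
    fun_prop
  obtain ⟨v, hv⟩ := exists_toLinearMap_root_eq_height b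
  have hmain : ∀ h : V, ∑ i ∈ s, ∑ j ∈ s.erase i, c i j * ((1 + a h i) * (1 + a h j)) *
        ∏ l ∈ (s.erase i).erase j, (1 - a h l)
      = (∑ i ∈ s, ∑ j ∈ s.erase i, c i j) * ∏ l ∈ s, (1 - a h l) := by
    have hfun := Continuous.ext_on (f := fun h : V => ∑ i ∈ s, ∑ j ∈ s.erase i,
        c i j * ((1 + a h i) * (1 + a h j)) * ∏ l ∈ (s.erase i).erase j, (1 - a h l))
      (g := fun h : V => (∑ i ∈ s, ∑ j ∈ s.erase i, c i j) * ∏ l ∈ s, (1 - a h l))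
      (dense_generic b) (by fun_prop) (by fun_prop) ?_
    · exact fun h => congrFun hfun h
    intro h hh
    have hp : ∀ i ∈ s, ((b.height i).toNat : ℝ) = b.height i := fun i hi => by
      have := mem_positiveRoots.1 hi
      exact_mod_cast Int.toNat_of_nonneg this.le
    have hline : ∀ i ∈ s, ∀ t : ℝ, Complex.exp (t * Complex.I) ^ (b.height i).toNat
        = Complex.exp (Complex.I * (P.toLinearMap (P.root i) (h + t • v) : ℝ)) * a h i := by
      intro i hi t
      simp only [a]
      rw [← Complex.exp_nat_mul, ← Complex.exp_add, map_add, map_smul, hv]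
      congr 1
      have hpc : ((b.height i).toNat : ℂ) = b.height i := by exact_mod_cast hp i hi
      rw [hpc]
      simp
      ring
    have hline' : ∀ i ∈ s, ∀ t : ℝ, Complex.exp (t * Complex.I) ^ (b.height i).toNat = a h i →
        ∃ n : ℤ, P.toLinearMap (P.root i) (h + t • v) = n * (2 * Real.pi) := by
      intro i hi t ht
      rw [hline i hi, mul_eq_right₀ (Complex.exp_ne_zero _), Complex.exp_eq_one_iff] at ht
      obtain ⟨n, hn⟩ := ht
      refine ⟨n, ?_⟩
      have : (Complex.I * (P.toLinearMap (P.root i) (h + t • v) : ℝ) : ℂ)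
        = Complex.I * (n * (2 * Real.pi) : ℝ) := by rw [hn]; push_cast; ring
      exact_mod_cast mul_left_cancel₀ Complex.I_ne_zero this
    have hunit : ∀ i ∈ s, ∀ w : ℂ, w ^ (b.height i).toNat = a h i →
        ∃ t : ℝ, Complex.exp (t * Complex.I) = w := by
      intro i hi w hw
      rw [← Complex.norm_eq_one_iff]
      have h1 := congrArg norm hw
      have h2 : ‖a h i‖ = 1 := by simp [a, Complex.norm_exp]
      rw [norm_pow, h2] at h1
      have := mem_positiveRoots.1 hi
      exact (pow_eq_one_iff_of_nonneg (norm_nonneg _) (by omega)).1 h1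
    refine sum_sum_eq_of_residues_eq_zero s (fun i => (b.height i).toNat) (fun i hi => ?_) (a h)
      (fun i _ => Complex.exp_ne_zero _) c (fun i j => ?_) ?_ ?_
    · have := mem_positiveRoots.1 hi
      omega
    · simp only [hc]
      rw [dualForm_comm, mul_comm (k i)]
    · intro i hi j hj hij w hwi hwj
      obtain ⟨t, rfl⟩ := hunit i hi w hwi
      obtain ⟨m, hm⟩ := hline' i hi t hwi
      obtain ⟨n, hn⟩ := hline' j hj t hwj
      refine hh i hi j hj hij (b.height j * m - b.height i * n) ?_
      rw [map_add, map_smul, hv, smul_eq_mul] at hm hn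
      push_cast
      linear_combination (b.height j : ℝ) * hm - (b.height i : ℝ) * hn
    · intro i hi w hw
      obtain ⟨t, rfl⟩ := hunit i hi w hw
      obtain ⟨n, hn⟩ := hline' i hi t hw
      have h0 := sum_dualForm_mul_cot_eq_zero hinner b hk i hn
      rw [← Finset.add_sum_erase _ _ hi] at h0
      have hci : Real.cot (P.toLinearMap (P.root i) (h + t • v) / 2) = 0 := by
        rw [Real.cot_eq_cos_div_sin, hn, show (n * (2 * Real.pi) / 2 : ℝ) = n * Real.pi by ring,
          Real.sin_int_mul_pi, div_zero]
      rw [hci, mul_zero, zero_add] at h0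
      have hterm : ∀ j ∈ s.erase i, c i j * ((Complex.exp (t * Complex.I) ^ (b.height j).toNat
            + a h j) / (Complex.exp (t * Complex.I) ^ (b.height j).toNat - a h j))
          = -Complex.I * k i * ((k j * dualForm P (P.root i) (P.root j) *
            Real.cot (P.toLinearMap (P.root j) (h + t • v) / 2) : ℝ) : ℂ) := by
        intro j hj
        have ha : a h j ≠ 0 := Complex.exp_ne_zero _
        rw [hline j (Finset.mem_of_mem_erase hj), ← add_one_mul, ← sub_one_mul,
          mul_div_mul_right _ _ ha, exp_add_one_div_exp_sub_one]
        simp only [hc]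
        push_cast
        ring
      rw [Finset.sum_congr rfl hterm, ← Finset.mul_sum, ← Complex.ofReal_sum, h0]
      simp
  have hne : ∀ l, 1 - a h l ≠ 0 := by
    intro l hl
    apply hreg l
    have h1 : a h l = 1 := (sub_eq_zero.1 hl).symm
    simp only [a] at h1
    rw [Complex.exp_eq_one_iff] at h1
    obtain ⟨n, hn⟩ := h1
    have h2 : (Complex.I * (P.toLinearMap (P.root l) h : ℝ) : ℂ)
        = Complex.I * ((-n : ℤ) * (2 * Real.pi) : ℝ) := by
      push_cast
      linear_combination -hn
    have h3 : P.toLinearMap (P.root l) h = (-n : ℤ) * (2 * Real.pi) := by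
      exact_mod_cast mul_left_cancel₀ Complex.I_ne_zero h2
    rw [h3, show ((-n : ℤ) * (2 * Real.pi) / 2 : ℝ) = (-n : ℤ) * Real.pi by ring,
      Real.sin_int_mul_pi]
  have hcot : ∀ l, (1 + a h l) / (1 - a h l)
      = -Complex.I * (Real.cot (P.toLinearMap (P.root l) h / 2) : ℝ) := by
    intro l
    rw [← exp_add_one_div_exp_sub_one]
    have ha : Complex.exp (Complex.I * (P.toLinearMap (P.root l) h : ℝ)) * a h l = 1 := by
      simp only [a]
      rw [← Complex.exp_add, add_neg_cancel, Complex.exp_zero]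
    have ha0 : a h l ≠ 0 := Complex.exp_ne_zero _
    rw [← mul_div_mul_right _ (_ - 1) ha0, add_mul, sub_mul, ha, one_mul]
  have hprod : ∏ l ∈ s, (1 - a h l) ≠ 0 := Finset.prod_ne_zero_iff.2 fun l _ => hne l
  have hfinal : (((∑ i ∈ s, ∑ j ∈ s.erase i, k i * k j * dualForm P (P.root i) (P.root j) *
        (Real.cot (P.toLinearMap (P.root i) h / 2) *
          Real.cot (P.toLinearMap (P.root j) h / 2)) : ℝ)) : ℂ) * ∏ l ∈ s, (1 - a h l)
      = (-(∑ i ∈ s, ∑ j ∈ s.erase i, k i * k j * dualForm P (P.root i) (P.root j)) : ℝ)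
        * ∏ l ∈ s, (1 - a h l) := by
    have h1 := hmain h
    rw [Complex.ofReal_neg, neg_mul]
    have h2 : (((∑ i ∈ s, ∑ j ∈ s.erase i, k i * k j * dualForm P (P.root i) (P.root j)) : ℝ) : ℂ)
        = ∑ i ∈ s, ∑ j ∈ s.erase i, c i j := by
      simp only [hc]; push_cast; rfl
    rw [h2, ← h1]
    push_cast
    rw [Finset.sum_mul, ← Finset.sum_neg_distrib]
    refine Finset.sum_congr rfl fun i hi => ?_
    rw [Finset.sum_mul, ← Finset.sum_neg_distrib]
    refine Finset.sum_congr rfl fun j hj => ?_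
    rw [← Finset.mul_prod_erase _ _ hi, ← Finset.mul_prod_erase _ _ hj]
    have e1 := (div_eq_iff (hne i)).1 (hcot i)
    have e2 := (div_eq_iff (hne j)).1 (hcot j)
    rw [e1, e2]
    simp only [hc]
    push_cast
    linear_combination ((k i * k j * dualForm P (P.root i) (P.root j) : ℂ) *
      Complex.cot ((P.toLinearMap (P.root i) h : ℂ) / 2) *
      Complex.cot ((P.toLinearMap (P.root j) h : ℂ) / 2) * (1 - a h i) * (1 - a h j) *
      ∏ l ∈ (s.erase i).erase j, (1 - a h l)) * (1 * Complex.I_sq)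
  exact_mod_cast mul_right_cancel₀ hprod hfinal

end CotIdentity
section IntegrationByParts

open scoped ComplexConjugate

variable {ι M V : Type*} [AddCommGroup M] [Module ℝ M]
  [NormedAddCommGroup V] [InnerProductSpace ℝ V] [FiniteDimensional ℝ V]
  {P : RootPairing ι ℝ M V}

/-- The derivative of a function on `T` in the direction `e ∈ 𝔥_ℝ`. -/
def dirDeriv (P : RootPairing ι ℝ M V) (e : V) (F : Torus P → ℂ) (t : Torus P) : ℂ :=
  fderiv ℝ (fun v => F (t + proj P v)) 0 e

lemma dirDeriv_proj (e : V) (F : Torus P → ℂ) (v : V) :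
    dirDeriv P e F (proj P v) = fderiv ℝ (fun v => F (proj P v)) v e := by
  have h : (fun w => F (proj P v + proj P w)) = fun w => (fun v => F (proj P v)) (v + w) := by
    ext w; simp
  have h' := fderiv_comp_add_left (𝕜 := ℝ) (f := fun v => F (proj P v)) (x := 0) v
  rw [dirDeriv, h, h', add_zero]

lemma laplacianT_proj (F : Torus P → ℂ) (v : V) :
    laplacianT P F (proj P v) = Laplacian.laplacian (fun v => F (proj P v)) v := by
  have h : (fun w => F (proj P v + proj P w)) = fun w => (fun v => F (proj P v)) (v + w) := by
    ext w; simp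
  rw [laplacianT, h, InnerProductSpace.laplacian_eq_iteratedFDeriv_stdOrthonormalBasis,
    InnerProductSpace.laplacian_eq_iteratedFDeriv_stdOrthonormalBasis]
  have h' := iteratedFDeriv_comp_add_left (𝕜 := ℝ) (f := fun v => F (proj P v)) 2 v 0
  beta_reduce at h' ⊢
  rw [h', add_zero]

lemma laplacian_eq_sum_fderiv_fderiv {κ : Type*} [Fintype κ] (e : OrthonormalBasis κ ℝ V)
    {f : V → ℂ} {v : V} (hf : ContDiffAt ℝ 2 f v) :
    Laplacian.laplacian f v = ∑ j, fderiv ℝ (fun v => fderiv ℝ f v (e j)) v (e j) := by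
  rw [InnerProductSpace.laplacian_eq_iteratedFDeriv_orthonormalBasis f e]
  refine Finset.sum_congr rfl fun j _ => ?_
  have hd : DifferentiableAt ℝ (fderiv ℝ f) v :=
    (hf.fderiv_right (m := 1) (by norm_num)).differentiableAt (by simp)
  rw [iteratedFDeriv_two_apply, fderiv_clm_apply hd (differentiableAt_const _)]
  simp

lemma contDiff_dirDeriv {F : Torus P → ℂ} (hF : IsC2 P F) (e : V) :
    ContDiff ℝ 1 fun v => dirDeriv P e F (proj P v) := by
  simp only [dirDeriv_proj]
  exact (ContDiff.fderiv_right (m := 1) hF (by norm_num)).clm_apply contDiff_const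

lemma laplacianT_eq_sum_dirDeriv {κ : Type*} [Fintype κ] (e : OrthonormalBasis κ ℝ V)
    {F : Torus P → ℂ} (hF : IsC2 P F) (t : Torus P) :
    laplacianT P F t = ∑ j, dirDeriv P (e j) (dirDeriv P (e j) F) t := by
  obtain ⟨v, rfl⟩ := proj_surjective P t
  rw [laplacianT_proj, laplacian_eq_sum_fderiv_fderiv e (ContDiff.contDiffAt hF)]
  simp only [dirDeriv_proj]

lemma continuous_dirDeriv {F : Torus P → ℂ} (hF : ContDiff ℝ 1 fun v => F (proj P v)) (e : V) :
    Continuous (dirDeriv P e F) := by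
  rw [(isQuotientMap_proj P).continuous_iff]
  have : dirDeriv P e F ∘ proj P = fun v => fderiv ℝ (fun v => F (proj P v)) v e :=
    funext fun v => dirDeriv_proj e F v
  rw [this]
  exact (hF.continuous_fderiv (by simp)).clm_apply continuous_const

lemma continuous_laplacianT {F : Torus P → ℂ} (hF : IsC2 P F) : Continuous (laplacianT P F) := by
  rw [funext (laplacianT_eq_sum_dirDeriv (stdOrthonormalBasis ℝ V) hF)]
  exact continuous_finsetSum _ fun j _ => continuous_dirDeriv (contDiff_dirDeriv hF _) _

variable [P.IsRootSystem]

lemma integrable_of_continuous {F : Torus P → ℂ} (hF : Continuous F) :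
    Integrable F (haarT P) := by
  obtain ⟨C, hC⟩ := isCompact_univ.exists_bound_of_continuousOn hF.continuousOn
  exact Integrable.of_bound hF.aestronglyMeasurable C (Eventually.of_forall fun t => hC t trivial)

lemma integral_dirDeriv {F : Torus P → ℂ} (hF : ContDiff ℝ 1 fun v => F (proj P v)) (e : V) :
    ∫ t, dirDeriv P e F t ∂haarT P = 0 := by
  have hFc : Continuous F := (isQuotientMap_proj P).continuous_iff.2 hF.continuous
  have hDc := continuous_dirDeriv hF e
  obtain ⟨C, hC⟩ := isCompact_univ.exists_bound_of_continuousOn hDc.continuousOn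
  have hder : ∀ t (s : ℝ), HasDerivAt (fun s : ℝ => F (t + proj P (s • e)))
      (dirDeriv P e F (t + proj P (s • e))) s := by
    intro t s
    obtain ⟨v, rfl⟩ := proj_surjective P t
    rw [← map_add, dirDeriv_proj]
    have h1 : HasDerivAt (fun s : ℝ => v + s • e) e s := by
      simpa using ((hasDerivAt_id s).smul_const e).const_add v
    have h2 := ((hF.differentiable (by simp)) (v + s • e)).hasFDerivAt.comp_hasDerivAt s h1
    refine h2.congr_of_eventuallyEq (Eventually.of_forall fun s => ?_)
    simp
  have h := (hasDerivAt_integral_of_dominated_loc_of_deriv_le (μ := haarT P)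
    (F := fun (s : ℝ) t => F (t + proj P (s • e)))
    (F' := fun (s : ℝ) t => dirDeriv P e F (t + proj P (s • e))) (x₀ := 0) (s := Set.univ)
    (bound := fun _ => C) univ_mem
    (Eventually.of_forall fun s => (hFc.comp (by fun_prop)).aestronglyMeasurable)
    (integrable_of_continuous (hFc.comp (by fun_prop)))
    ((hDc.comp (by fun_prop)).aestronglyMeasurable)
    (Eventually.of_forall fun t s _ => hC _ trivial) (integrable_const C)
    (Eventually.of_forall fun t s _ => hder t s)).2
  have hconst : (fun s : ℝ => ∫ t, F (t + proj P (s • e)) ∂haarT P)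
      = fun _ => ∫ t, F t ∂haarT P := funext fun s => integral_add_right_eq_self F _
  rw [hconst] at h
  have h0 := h.unique (hasDerivAt_const _ _)
  simpa using h0

lemma integral_conj_mul_laplacianT {F G : Torus P → ℂ} (hF : IsC2 P F) (hG : IsC2 P G) :
    ∫ t, conj (laplacianT P F t) * G t ∂haarT P = ∫ t, conj (F t) * laplacianT P G t ∂haarT P := by
  set e := stdOrthonormalBasis ℝ V
  have hDF := fun j => contDiff_dirDeriv hF (e j)
  have hDG := fun j => contDiff_dirDeriv hG (e j)
  have hFd : ContDiff ℝ 1 fun v => F (proj P v) := ContDiff.of_le hF (by norm_num)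
  have hGd : ContDiff ℝ 1 fun v => G (proj P v) := ContDiff.of_le hG (by norm_num)
  let J : _ → Torus P → ℂ := fun j t =>
    conj (F t) * dirDeriv P (e j) G t - conj (dirDeriv P (e j) F t) * G t
  have hconj : ∀ {f : V → ℂ}, ContDiff ℝ 1 f → ContDiff ℝ 1 fun v => conj (f v) := fun hf =>
    Complex.conjCLE.contDiff.comp hf
  have hJ : ∀ j, ContDiff ℝ 1 fun v => J j (proj P v) := fun j =>
    ((hconj hFd).mul (hDG j)).sub ((hconj (hDF j)).mul hGd)
  have hconjd : ∀ {f : V → ℂ} (v w : V), ContDiff ℝ 1 f →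
      fderiv ℝ (fun v => conj (f v)) v w = conj (fderiv ℝ f v w) := fun {f} v w hf => by
    have h := (Complex.conjCLE.toContinuousLinearMap.hasFDerivAt (x := f v)).comp v
      ((hf.differentiable (by simp)) v).hasFDerivAt
    have h' : fderiv ℝ (fun v => conj (f v)) v = _ := h.fderiv
    rw [h']
    rfl
  have hDJ : ∀ j t, dirDeriv P (e j) (J j) t = conj (F t) * dirDeriv P (e j) (dirDeriv P (e j) G) t
      - conj (dirDeriv P (e j) (dirDeriv P (e j) F) t) * G t := by
    intro j t
    obtain ⟨v, rfl⟩ := proj_surjective P t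
    rw [dirDeriv_proj, dirDeriv_proj _ (dirDeriv P (e j) G), dirDeriv_proj _ (dirDeriv P (e j) F)]
    have d1 := ((hconj hFd).differentiable (by simp)) v
    have d2 := ((hDG j).differentiable (by simp)) v
    have d3 := ((hconj (hDF j)).differentiable (by simp)) v
    have d4 := (hGd.differentiable (by simp)) v
    simp only [J]
    rw [fderiv_fun_sub (d1.fun_mul d2) (d3.fun_mul d4), fderiv_fun_mul d1 d2, fderiv_fun_mul d3 d4]
    simp only [_root_.sub_apply, _root_.add_apply,
      _root_.smul_apply, smul_eq_mul, hconjd v _ hFd, hconjd v _ (hDF j),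
      ← dirDeriv_proj]
    ring
  have hF0 := hF.continuous
  have hG0 := hG.continuous
  have c1 := fun j => continuous_dirDeriv (hDF j) (e j)
  have c2 := fun j => continuous_dirDeriv (hDG j) (e j)
  have hL1 := continuous_laplacianT hF
  have hL2 := continuous_laplacianT hG
  rw [eq_comm, ← sub_eq_zero, ← integral_sub]
  · have : (fun t => conj (F t) * laplacianT P G t - conj (laplacianT P F t) * G t)
        = fun t => ∑ j, dirDeriv P (e j) (J j) t := by
      ext t
      simp only [hDJ, Finset.sum_sub_distrib, ← Finset.mul_sum, ← Finset.sum_mul, ← map_sum]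
      rw [laplacianT_eq_sum_dirDeriv e hF, laplacianT_eq_sum_dirDeriv e hG]
    rw [this, integral_finsetSum]
    · exact Finset.sum_eq_zero fun j _ => integral_dirDeriv (hJ j) _
    · exact fun j _ => integrable_of_continuous (continuous_dirDeriv (hJ j) _)
  · exact integrable_of_continuous (by fun_prop)
  · exact integrable_of_continuous (by fun_prop)

end IntegrationByParts
section WeylInvariance

variable {ι M V : Type*} [AddCommGroup M] [Module ℝ M]
  [NormedAddCommGroup V] [InnerProductSpace ℝ V] [FiniteDimensional ℝ V]
  {P : RootPairing ι ℝ M V}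

/-- Invariance under the Weyl group can be tested on reflections. -/
lemma apply_weylTorus_of_coreflection {A : Type*} {F : Torus P → A}
    (hF : ∀ i h, F (proj P (P.coreflection i h)) = F (proj P h)) (w : weylGroup P) (t : Torus P) :
    F (weylTorus P w t) = F t := by
  obtain ⟨h, rfl⟩ := proj_surjective P t
  rw [weylTorus_proj]
  obtain ⟨w, hw⟩ := w
  simp only
  induction hw using Subgroup.closure_induction generalizing h with
  | mem x hx => obtain ⟨i, rfl⟩ := hx; exact hF i h
  | one => rfl
  | mul x y _ _ hx hy => exact (hx (y h)).trans (hy h)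
  | inv x _ hx =>
    have := hx (x⁻¹ h)
    rw [← this, ← LinearEquiv.mul_apply, mul_inv_cancel]
    rfl

lemma IsWeylInvariant.coreflection {F : Torus P → ℂ} (hF : IsWeylInvariant P F) (i : ι) (h : V) :
    F (proj P (P.coreflection i h)) = F (proj P h) :=
  hF ⟨_, coreflection_mem_weylGroup P i⟩ (proj P h)

lemma finite_weylGroup [Finite ι] [P.IsRootSystem] : Finite (weylGroup P) := by
  have hmaps : ∀ w : weylGroup P, ∀ i, (w : V ≃ₗ[ℝ] V) (P.coroot i) ∈ Set.range P.coroot := by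
    rintro ⟨w, hw⟩
    simp only
    induction hw using Subgroup.closure_induction'' with
    | mem x hx =>
      obtain ⟨j, rfl⟩ := hx
      exact fun i => ⟨P.reflectionPerm j i, by simp⟩
    | one => exact fun i => ⟨i, rfl⟩
    | inv_mem x hx =>
      obtain ⟨j, rfl⟩ := hx
      exact fun i => ⟨P.reflectionPerm j i, by
        rw [P.coroot_reflectionPerm]; rfl⟩
    | mul x y _ _ hx hy =>
      intro i
      obtain ⟨j, hj⟩ := hy i
      obtain ⟨l, hl⟩ := hx j
      exact ⟨l, by rw [hl, hj]; rfl⟩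
  refine Finite.of_injective (β := ι → Set.range P.coroot)
    (fun w i => ⟨(w : V ≃ₗ[ℝ] V) (P.coroot i), hmaps w i⟩) fun w w' h => ?_
  apply Subtype.ext
  apply LinearEquiv.toLinearMap_injective
  refine LinearMap.ext_on_range (v := P.coroot) RootPairing.IsRootSystem.span_coroot_eq_top
    fun i => ?_
  exact congrArg Subtype.val (congrFun h i)

lemma coe_mem_L2W_of_ae_eq [P.IsRootSystem] {f : Lp ℂ 2 (haarT P)} {F : Torus P → ℂ}
    (hf : f =ᵐ[haarT P] F) (hF : IsWeylInvariant P F) : f ∈ L2W P := by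
  intro w
  apply Lp.ext
  have hmp := measurePreserving_weylTorus P w
  refine (Lp.coeFn_compMeasurePreserving f hmp).trans
    (EventuallyEq.trans (hmp.quasiMeasurePreserving.ae_eq_comp hf) ?_)
  refine EventuallyEq.trans (Eventually.of_forall fun t => ?_) hf.symm
  exact hF w t

end WeylInvariance

section Functions

variable {ι M V : Type*} [Fintype ι] [AddCommGroup M] [Module ℝ M]
  [NormedAddCommGroup V] [InnerProductSpace ℝ V] [FiniteDimensional ℝ V]
  {P : RootPairing ι ℝ M V}

lemma expWeight_proj (x : weightLattice P) (h : V) :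
    expWeight P x (proj P h) = Complex.exp (Complex.I * (P.toLinearMap (x : M) h : ℝ)) := rfl

lemma expWeight_zero : expWeight P 0 = 1 := by
  ext t
  obtain ⟨h, rfl⟩ := proj_surjective P t
  simp [expWeight_proj]

lemma expWeight_add (x y : weightLattice P) :
    expWeight P (x + y) = expWeight P x * expWeight P y := by
  ext t
  obtain ⟨h, rfl⟩ := proj_surjective P t
  simp only [Pi.mul_apply, expWeight_proj, ← Complex.exp_add]
  congr 1
  simp
  ring

lemma expWeight_neg (x : weightLattice P) (t : Torus P) :
    expWeight P (-x) t = (starRingEnd ℂ) (expWeight P x t) := by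
  obtain ⟨h, rfl⟩ := proj_surjective P t
  simp only [expWeight_proj, ← Complex.exp_conj]
  congr 1
  simp

lemma expWeight_apply_add (x : weightLattice P) (s t : Torus P) :
    expWeight P x (s + t) = expWeight P x s * expWeight P x t := by
  obtain ⟨h, rfl⟩ := proj_surjective P t
  obtain ⟨g, rfl⟩ := proj_surjective P s
  rw [← map_add]
  simp only [expWeight_proj, ← Complex.exp_add]
  congr 1
  simp
  ring

lemma continuous_expWeight (x : weightLattice P) : Continuous (expWeight P x) := by
  rw [(isQuotientMap_proj P).continuous_iff]
  have : Continuous fun h : V => P.toLinearMap (x : M) h :=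
    LinearMap.continuous_of_finiteDimensional _
  change Continuous fun h : V => Complex.exp (Complex.I * (P.toLinearMap (x : M) h : ℝ))
  fun_prop

lemma expWeight_apply_sub (x : weightLattice P) (s t : Torus P) (h : expWeight P x t = 1) :
    expWeight P x (s - t) = expWeight P x s := by
  have h1 := expWeight_apply_add x (s - t) t
  rw [sub_add_cancel, h, mul_one] at h1
  exact h1.symm

/-- The functions `e^λ` separate the points of `T`. -/
lemma eq_zero_of_forall_expWeight_eq_one (b : P.Base) [P.IsRootSystem] {t : Torus P}
    (ht : ∀ x, expWeight P x t = 1) : t = 0 := by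
  obtain ⟨v, rfl⟩ := proj_surjective P t
  have hrepr : ∀ j, b.toCoweightBasis.coord j v ∈ Set.range fun n : ℤ => n * (2 * Real.pi) := by
    intro j
    obtain ⟨x, hx⟩ := (LinearMap.IsPerfPair.bijective_left P.toLinearMap).2
      (b.toCoweightBasis.coord j)
    have hxw : x ∈ weightLattice P := by
      intro i
      have hi := b.coroot_mem_span_int i
      rw [hx]
      generalize P.coroot i = y at hi ⊢
      induction hi using Submodule.span_induction with
      | mem y hy =>
        classical
        obtain ⟨l, hl, rfl⟩ := hy
        refine ⟨if l = j then 1 else 0, ?_⟩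
        rw [← b.toCoweightBasis_apply ⟨l, hl⟩, Module.Basis.coord_apply, Module.Basis.repr_self,
          Finsupp.single_apply]
        simp only [Subtype.ext_iff]
        split_ifs <;> simp
      | zero => exact ⟨0, by simp⟩
      | add y z _ _ hy hz =>
        obtain ⟨m, hm⟩ := hy
        obtain ⟨n, hn⟩ := hz
        exact ⟨m + n, by rw [map_add, hm, hn]; push_cast; ring⟩
      | smul c y _ hy =>
        obtain ⟨m, hm⟩ := hy
        exact ⟨c * m, by rw [map_zsmul, hm]; simp⟩
    have h1 := ht ⟨x, hxw⟩
    rw [expWeight_proj, Complex.exp_eq_one_iff] at h1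
    obtain ⟨n, hn⟩ := h1
    refine ⟨n, ?_⟩
    have h2 : (Complex.I * (P.toLinearMap x v : ℝ) : ℂ)
        = Complex.I * (n * (2 * Real.pi) : ℝ) := by rw [hn]; push_cast; ring
    have h3 : P.toLinearMap x v = n * (2 * Real.pi) := by
      exact_mod_cast mul_left_cancel₀ Complex.I_ne_zero h2
    rw [← hx, h3]
  rw [proj_eq_zero_iff, ← b.toCoweightBasis.sum_repr v]
  refine AddSubgroup.sum_mem _ fun j _ => ?_
  obtain ⟨n, hn⟩ := hrepr j
  rw [Module.Basis.coord_apply] at hn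
  rw [← hn, b.toCoweightBasis_apply, mul_smul]
  rw [Int.cast_smul_eq_zsmul ℝ]
  exact AddSubgroup.zsmul_mem _ (AddSubgroup.subset_closure (Set.mem_range_self _)) _

lemma eq_of_forall_expWeight_eq (b : P.Base) [P.IsRootSystem] {s t : Torus P}
    (h : ∀ x, expWeight P x s = expWeight P x t) : s = t := by
  rw [← sub_eq_zero]
  refine eq_zero_of_forall_expWeight_eq_one b fun x => ?_
  have h1 := expWeight_apply_add x (s - t) t
  rw [sub_add_cancel, h] at h1
  have h0 : expWeight P x t ≠ 0 := by
    obtain ⟨v, rfl⟩ := proj_surjective P t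
    exact Complex.exp_ne_zero _
  exact (mul_eq_right₀ h0).1 h1.symm

lemma t2Space_torus (b : P.Base) [P.IsRootSystem] : T2Space (Torus P) :=
  T2Space.of_injective_continuous (f := fun t => fun x : weightLattice P => expWeight P x t)
    (fun _ _ h => eq_of_forall_expWeight_eq b fun x => congrFun h x)
    (continuous_pi continuous_expWeight)

/-- `e^λ` as a continuous map. -/
def expWeightC (P : RootPairing ι ℝ M V) (x : weightLattice P) : C(Torus P, ℂ) :=
  ⟨expWeight P x, continuous_expWeight x⟩

lemma span_expWeightC_dense (b : P.Base) [P.IsRootSystem] :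
    (Submodule.span ℂ (Set.range (expWeightC P))).topologicalClosure = ⊤ := by
  let A : StarSubalgebra ℂ C(Torus P, ℂ) :=
    { toSubalgebra := Algebra.adjoin ℂ (Set.range (expWeightC P))
      star_mem' := by
        change Algebra.adjoin ℂ (Set.range (expWeightC P)) ≤
          star (Algebra.adjoin ℂ (Set.range (expWeightC P)))
        refine Algebra.adjoin_le ?_
        rintro - ⟨x, rfl⟩
        exact Algebra.subset_adjoin ⟨-x, ContinuousMap.ext fun t => expWeight_neg x t⟩ }
  have hA : Subalgebra.toSubmodule A.toSubalgebra
      = Submodule.span ℂ (Set.range (expWeightC P)) := by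
    apply Algebra.adjoin_eq_span_of_subset
    refine Set.Subset.trans ?_ Submodule.subset_span
    intro f hf
    refine Submonoid.closure_induction (fun _ => id) ⟨0, ?_⟩ ?_ hf
    · exact ContinuousMap.ext fun t => congrFun expWeight_zero t
    · rintro - - - - ⟨x, rfl⟩ ⟨y, rfl⟩
      exact ⟨x + y, ContinuousMap.ext fun t => congrFun (expWeight_add x y) t⟩
  have hsep : A.SeparatesPoints := by
    intro s t hst
    by_contra! hne
    exact hst (eq_of_forall_expWeight_eq b fun x =>
      hne _ ⟨expWeightC P x, Algebra.subset_adjoin ⟨x, rfl⟩, rfl⟩)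
  rw [← hA]
  exact congr_arg (Subalgebra.toSubmodule <| StarSubalgebra.toSubalgebra ·)
    (ContinuousMap.starSubalgebra_topologicalClosure_eq_top_of_separatesPoints A hsep)

instance [P.IsRootSystem] : (haarT P).Regular :=
  inferInstanceAs (Measure.addHaarMeasure _).Regular

/-- A square integrable function all of whose Fourier coefficients vanish is zero. -/
lemma ae_eq_zero_of_forall_integral_expWeight (b : P.Base) [P.IsRootSystem] {g : Torus P → ℂ}
    (hg : MemLp g 2 (haarT P))
    (h : ∀ x, ∫ t, (starRingEnd ℂ) (expWeight P x t) * g t ∂haarT P = 0) :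
    g =ᵐ[haarT P] 0 := by
  have := t2Space_torus b
  have hdense : Dense (Submodule.map (ContinuousMap.toLp (E := ℂ) 2 (haarT P) ℂ).toLinearMap
      (Submodule.span ℂ (Set.range (expWeightC P))) : Set (Lp ℂ 2 (haarT P))) := by
    have h1 : Dense (Submodule.span ℂ (Set.range (expWeightC P)) : Set C(Torus P, ℂ)) :=
      (Submodule.dense_iff_topologicalClosure_eq_top).2 (span_expWeightC_dense b)
    exact (ContinuousMap.toLp_denseRange ℂ (haarT P) ℂ (by norm_num)).dense_image
      (ContinuousMap.toLp (E := ℂ) 2 (haarT P) ℂ).continuous h1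
  have hzero : hg.toLp g = 0 := by
    refine hdense.eq_zero_of_inner_right ℂ ?_
    rintro - ⟨q, hq, rfl⟩
    induction hq using Submodule.span_induction with
    | mem y hy =>
      obtain ⟨x, rfl⟩ := hy
      rw [L2.inner_def, ← h x]
      refine integral_congr_ae ?_
      filter_upwards [ContinuousMap.coeFn_toLp (p := 2) (𝕜 := ℂ) (haarT P) (expWeightC P x),
        hg.coeFn_toLp] with t h1 h2
      rw [h2]
      have h1' : ((ContinuousMap.toLp (E := ℂ) 2 (haarT P) ℂ).toLinearMap (expWeightC P x) :
        Lp ℂ 2 (haarT P)) t = expWeight P x t := h1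
      rw [h1']
      simp [mul_comm]
    | zero => simp
    | add y z _ _ hy hz => rw [map_add, inner_add_left, hy, hz, add_zero]
    | smul c y _ hy => rw [map_smul, inner_smul_left, hy, mul_zero]
  exact hg.coeFn_toLp.symm.trans (by rw [hzero]; exact Lp.coeFn_zero _ _ _)

lemma absSin_proj [P.IsCrystallographic] (i : ι) (h : V) :
    absSin P i (proj P h) = |Real.sin (P.toLinearMap (P.root i) h / 2)| := rfl

lemma continuous_absSin [P.IsCrystallographic] (i : ι) : Continuous (absSin P i) := by
  rw [(isQuotientMap_proj P).continuous_iff]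
  have : Continuous fun h : V => P.toLinearMap (P.root i) h :=
    LinearMap.continuous_of_finiteDimensional _
  change Continuous fun h : V => |Real.sin (P.toLinearMap (P.root i) h / 2)|
  fun_prop

lemma expWeight_root_eq_one_of_absSin_eq_zero [P.IsCrystallographic] {i : ι} {t : Torus P}
    (ht : absSin P i t = 0) : expWeight P ⟨P.root i, root_mem_weightLattice P i⟩ t = 1 := by
  obtain ⟨h, rfl⟩ := proj_surjective P t
  rw [absSin_proj, abs_eq_zero, Real.sin_eq_zero_iff] at ht
  obtain ⟨n, hn⟩ := ht
  rw [expWeight_proj, Complex.exp_eq_one_iff]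
  refine ⟨n, ?_⟩
  have : P.toLinearMap (P.root i) h = n * (2 * Real.pi) := by linarith
  simp only [this]
  push_cast
  ring

/-- The walls are null sets. -/
lemma ae_absSin_ne_zero [P.IsRootSystem] [P.IsCrystallographic] :
    ∀ᵐ t ∂haarT P, ∀ i, absSin P i t ≠ 0 := by
  rw [ae_all_iff]
  intro i
  set x : weightLattice P := ⟨P.root i, root_mem_weightLattice P i⟩ with hx
  set K : Set (Torus P) := {t | expWeight P x t = 1} with hK
  have hKc : IsClosed K := isClosed_eq (continuous_expWeight x) continuous_const
  suffices hK0 : haarT P K = 0 by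
    refine measure_mono_null (fun t ht => ?_) hK0
    simp only [Set.mem_compl_iff, Set.mem_ofPred_eq, not_not] at ht
    exact expWeight_root_eq_one_of_absSin_eq_zero ht
  by_contra hne
  have hnhds := Measure.sub_mem_nhds_zero_of_addHaar_pos_ne_top (haarT P) K hKc.measurableSet
    (pos_iff_ne_zero.2 hne) (measure_ne_top _ _)
  have hKnhds : K ∈ 𝓝 (0 : Torus P) := by
    refine mem_of_superset hnhds ?_
    rintro - ⟨s, hs, t, ht, rfl⟩
    change expWeight P x (s - t) = 1
    rw [expWeight_apply_sub x s t ht]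
    exact hs
  have hc : Continuous fun s : ℝ => proj P (s • P.coroot i) :=
    (isQuotientMap_proj P).continuous.comp (by fun_prop)
  have hev : ∀ᶠ s in 𝓝 (0 : ℝ), proj P (s • P.coroot i) ∈ K := by
    refine hc.continuousAt.eventually ?_
    simpa using hKnhds
  obtain ⟨ε, hε, hball⟩ := Metric.eventually_nhds_iff.1 hev
  have hs0 : 0 < min (ε / 2) 1 := by positivity
  have hmem := hball (y := min (ε / 2) 1) (by
    rw [dist_zero_right, Real.norm_of_nonneg hs0.le]
    exact (min_le_left _ _).trans_lt (by linarith))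
  have h1 : expWeight P x (proj P (min (ε / 2) 1 • P.coroot i)) = 1 := hmem
  rw [expWeight_proj, map_smul, hx, P.root_coroot_two, Complex.exp_eq_one_iff] at h1
  obtain ⟨n, hn⟩ := h1
  have h2 : (Complex.I * ((min (ε / 2) 1 • (2 : ℝ) : ℝ) : ℂ))
      = Complex.I * (n * (2 * Real.pi) : ℝ) := by rw [hn]; push_cast; ring
  have h3 : min (ε / 2) 1 • (2 : ℝ) = n * (2 * Real.pi) := by
    exact_mod_cast mul_left_cancel₀ Complex.I_ne_zero h2
  rw [smul_eq_mul] at h3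
  have h4 : min (ε / 2) 1 = n * Real.pi := by linarith
  have hpi := Real.pi_gt_three
  have hn1 : 0 < n := by
    by_contra hle
    have : (n : ℝ) ≤ 0 := by exact_mod_cast not_lt.1 hle
    nlinarith
  have hn2 : (1 : ℝ) ≤ n := by exact_mod_cast hn1
  have := min_le_right (ε / 2) 1
  nlinarith

lemma absSin_reflectionPerm [P.IsCrystallographic] (i j : ι) (h : V) :
    absSin P (P.reflectionPerm i j) (proj P h) = absSin P j (proj P (P.coreflection i h)) := by
  rw [absSin_proj, absSin_proj, toLinearMap_root_reflectionPerm]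

lemma absSin_reflectionPerm_self [P.IsCrystallographic] (i : ι) (t : Torus P) :
    absSin P (P.reflectionPerm i i) t = absSin P i t := by
  obtain ⟨h, rfl⟩ := proj_surjective P t
  rw [absSin_proj, absSin_proj, root_reflectionPerm_self, map_neg, LinearMap.neg_apply, neg_div,
    Real.sin_neg, abs_neg]

lemma absSin_nonneg [P.IsCrystallographic] (i : ι) (t : Torus P) : 0 ≤ absSin P i t := by
  obtain ⟨h, rfl⟩ := proj_surjective P t
  exact abs_nonneg _

variable [P.IsRootSystem] [P.IsCrystallographic] [P.IsReduced]

lemma groundState_nonneg (b : P.Base) (k : ι → ℝ) (t : Torus P) : 0 ≤ groundState P b k t :=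
  Finset.prod_nonneg fun i _ => Real.rpow_nonneg (absSin_nonneg i t) _

lemma groundState_pos (b : P.Base) (k : ι → ℝ) {t : Torus P} (ht : ∀ i, absSin P i t ≠ 0) :
    0 < groundState P b k t :=
  Finset.prod_pos fun i _ => Real.rpow_pos_of_pos ((absSin_nonneg i t).lt_of_ne' (ht i)) _

lemma continuous_groundState (b : P.Base) {k : ι → ℝ} (hk : ∀ i, 0 ≤ k i) :
    Continuous (groundState P b k) :=
  continuous_finsetProd _ fun i _ => (continuous_absSin i).rpow_const fun _ => Or.inr (hk i)

lemma groundState_weylTorus (b : P.Base) {k : ι → ℝ} (hk : IsInvariantMult P k)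
    (w : weylGroup P) (t : Torus P) : groundState P b k (weylTorus P w t) = groundState P b k t := by
  refine apply_weylTorus_of_coreflection (fun i h => ?_) w t
  have hsq : ∀ t : Torus P, groundState P b k t * groundState P b k t
      = ∏ j, absSin P j t ^ k j := fun t => by
    refine (prod_eq_prod_positiveRoots_mul_self b _ fun j => ?_).symm
    rw [absSin_reflectionPerm_self, hk.reflectionPerm]
  refine (mul_self_inj (groundState_nonneg b k _) (groundState_nonneg b k _)).1 ?_
  rw [hsq, hsq]
  refine Fintype.prod_equiv (P.reflectionPerm i) _ _ fun j => ?_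
  rw [hk.reflectionPerm, absSin_reflectionPerm]

end Functions
section LineDerivatives

variable {V : Type*} [NormedAddCommGroup V] [InnerProductSpace ℝ V] [FiniteDimensional ℝ V]

lemma hasDerivAt_add_smul (h e : V) (s : ℝ) : HasDerivAt (fun s : ℝ => h + s • e) e s := by
  simpa using ((hasDerivAt_id s).smul_const e).const_add h

lemma fderiv_apply_eq_of_hasDerivAt {f : V → ℂ} {h e : V} {s : ℝ} {f' : ℂ}
    (hf : DifferentiableAt ℝ f (h + s • e)) (hd : HasDerivAt (fun s : ℝ => f (h + s • e)) f' s) :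
    fderiv ℝ f (h + s • e) e = f' :=
  (hf.hasFDerivAt.comp_hasDerivAt s (hasDerivAt_add_smul h e s)).unique hd

lemma fderiv_fderiv_apply_eq_of_hasDerivAt {f : V → ℂ} (hf : ContDiff ℝ 2 f) {h e : V}
    {f₁ : ℝ → ℂ} {f₂ : ℂ} (h1 : ∀ᶠ s in 𝓝 (0 : ℝ), HasDerivAt (fun s : ℝ => f (h + s • e)) (f₁ s) s)
    (h2 : HasDerivAt f₁ f₂ 0) : fderiv ℝ (fun v => fderiv ℝ f v e) h e = f₂ := by
  have hd : ContDiff ℝ 1 fun v => fderiv ℝ f v e :=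
    (hf.fderiv_right (m := 1) (by norm_num)).clm_apply contDiff_const
  have h3 : HasDerivAt (fun s : ℝ => fderiv ℝ f (h + s • e) e) f₂ 0 := by
    refine h2.congr_of_eventuallyEq ?_
    filter_upwards [h1] with s hs
    exact fderiv_apply_eq_of_hasDerivAt ((hf.differentiable (by simp)) _) hs
  have := fderiv_apply_eq_of_hasDerivAt ((hd.differentiable (by simp)) _) h3
  simpa using this

end LineDerivatives

section GroundStateConjugation

variable {ι M V : Type*} [Fintype ι] [AddCommGroup M] [Module ℝ M]
  [NormedAddCommGroup V] [InnerProductSpace ℝ V] [FiniteDimensional ℝ V]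
  {P : RootPairing ι ℝ M V} [P.IsCrystallographic] [P.IsReduced]

/-- The derivative of `log Δ` in the direction `e`. -/
def logDerivGroundState (P : RootPairing ι ℝ M V) [P.IsCrystallographic] [P.IsReduced]
    (b : P.Base) (k : ι → ℝ) (e h : V) : ℝ :=
  ∑ i ∈ positiveRoots P b,
    k i * Real.cot (P.toLinearMap (P.root i) h / 2) * (P.toLinearMap (P.root i) e / 2)

lemma groundState_proj (b : P.Base) (k : ι → ℝ) (h : V) : groundState P b k (proj P h)
    = ∏ i ∈ positiveRoots P b, |Real.sin (P.toLinearMap (P.root i) h / 2)| ^ k i := rfl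

lemma hasDerivAt_root_div_two (i : ι) (h e : V) (s : ℝ) :
    HasDerivAt (fun s : ℝ => P.toLinearMap (P.root i) (h + s • e) / 2)
      (P.toLinearMap (P.root i) e / 2) s := by
  have : (fun s : ℝ => P.toLinearMap (P.root i) (h + s • e) / 2)
      = fun s : ℝ => P.toLinearMap (P.root i) h / 2 + s * (P.toLinearMap (P.root i) e / 2) := by
    ext s
    simp
    ring
  rw [this]
  simpa using ((hasDerivAt_id s).mul_const (P.toLinearMap (P.root i) e / 2)).const_add
    (P.toLinearMap (P.root i) h / 2)

lemma hasDerivAt_groundState (b : P.Base) (k : ι → ℝ) (h e : V) {s : ℝ}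
    (hs : ∀ i, Real.sin (P.toLinearMap (P.root i) (h + s • e) / 2) ≠ 0) :
    HasDerivAt (fun s : ℝ => groundState P b k (proj P (h + s • e)))
      (groundState P b k (proj P (h + s • e)) * logDerivGroundState P b k e (h + s • e)) s := by
  classical
  have h1 : ∀ i ∈ positiveRoots P b, HasDerivAt
      (fun s : ℝ => |Real.sin (P.toLinearMap (P.root i) (h + s • e) / 2)| ^ k i)
      (k i * Real.cot (P.toLinearMap (P.root i) (h + s • e) / 2) *
        |Real.sin (P.toLinearMap (P.root i) (h + s • e) / 2)| ^ k i *
          (P.toLinearMap (P.root i) e / 2)) s := fun i _ => by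
    have hd := (hasDerivAt_abs_sin_rpow (k i) (hs i)).comp s (hasDerivAt_root_div_two i h e s)
    exact hd
  refine (HasDerivAt.fun_finsetProd h1).congr_deriv ?_
  rw [logDerivGroundState, Finset.mul_sum]
  refine Finset.sum_congr rfl fun i hi => ?_
  rw [groundState_proj, ← Finset.mul_prod_erase _ _ hi, smul_eq_mul]
  ring

lemma hasDerivAt_logDerivGroundState (b : P.Base) (k : ι → ℝ) (h e : V) {s : ℝ}
    (hs : ∀ i, Real.sin (P.toLinearMap (P.root i) (h + s • e) / 2) ≠ 0) :
    HasDerivAt (fun s : ℝ => logDerivGroundState P b k e (h + s • e))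
      (∑ i ∈ positiveRoots P b, -(k i * (P.toLinearMap (P.root i) e) ^ 2 /
        (4 * Real.sin (P.toLinearMap (P.root i) (h + s • e) / 2) ^ 2))) s := by
  simp only [logDerivGroundState]
  refine HasDerivAt.fun_sum fun i _ => ?_
  have h1 := (((hasDerivAt_cot (hs i)).comp s (hasDerivAt_root_div_two i h e s)).const_mul
    (k i)).mul_const (P.toLinearMap (P.root i) e / 2)
  refine h1.congr_deriv ?_
  have := hs i
  field_simp
  ring

lemma contDiff_groundState (b : P.Base) {k : ι → ℝ} (hk : ∀ i, 2 ≤ k i) :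
    ContDiff ℝ 2 fun h => groundState P b k (proj P h) := by
  simp only [groundState_proj]
  refine contDiff_prod fun i _ => (contDiff_two_abs_rpow (hk i)).comp ?_
  have : ContDiff ℝ 2 fun h : V => P.toLinearMap (P.root i) h :=
    (LinearMap.toContinuousLinearMap (P.toLinearMap (P.root i))).contDiff
  exact Real.contDiff_sin.comp (this.div_const 2)

lemma eventually_sin_ne_zero {h : V} (e : V)
    (hreg : ∀ i, Real.sin (P.toLinearMap (P.root i) h / 2) ≠ 0) :
    ∀ᶠ s in 𝓝 (0 : ℝ), ∀ i, Real.sin (P.toLinearMap (P.root i) (h + s • e) / 2) ≠ 0 := by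
  rw [eventually_all]
  intro i
  have hc : ContinuousAt (fun s : ℝ => Real.sin (P.toLinearMap (P.root i) (h + s • e) / 2)) 0 :=
    (Real.continuous_sin.continuousAt).comp (hasDerivAt_root_div_two i h e 0).continuousAt
  exact hc.eventually_ne (by simpa using hreg i)

lemma laplacian_mul_groundState {κ : Type*} [Fintype κ] (e : OrthonormalBasis κ ℝ V) (b : P.Base)
    {k : ι → ℝ} (hk : ∀ i, 2 ≤ k i) {f : V → ℂ} (hf : ContDiff ℝ 2 f) {h : V}
    (hreg : ∀ i, Real.sin (P.toLinearMap (P.root i) h / 2) ≠ 0) :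
    Laplacian.laplacian (fun v => f v * (groundState P b k (proj P v) : ℂ)) h
      = groundState P b k (proj P h) * (Laplacian.laplacian f h
        + 2 * ∑ j, logDerivGroundState P b k (e j) h * fderiv ℝ f h (e j)
        + f h * ∑ j, ((logDerivGroundState P b k (e j) h ^ 2 + ∑ i ∈ positiveRoots P b,
          -(k i * (P.toLinearMap (P.root i) (e j)) ^ 2 /
            (4 * Real.sin (P.toLinearMap (P.root i) h / 2) ^ 2)) : ℝ) : ℂ)) := by
  have hF : ContDiff ℝ 2 fun v => f v * (groundState P b k (proj P v) : ℂ) :=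
    hf.mul (Complex.ofRealCLM.contDiff.comp (contDiff_groundState b hk))
  rw [laplacian_eq_sum_fderiv_fderiv e hF.contDiffAt,
    laplacian_eq_sum_fderiv_fderiv e hf.contDiffAt, Finset.mul_sum, Finset.mul_sum,
    ← Finset.sum_add_distrib, ← Finset.sum_add_distrib, Finset.mul_sum]
  refine Finset.sum_congr rfl fun j _ => ?_
  have hf1 : ∀ s : ℝ, HasDerivAt (fun s : ℝ => f (h + s • e j)) (fderiv ℝ f (h + s • e j) (e j)) s :=
    fun s => ((hf.differentiable (by simp)) _).hasFDerivAt.comp_hasDerivAt s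
      (hasDerivAt_add_smul h (e j) s)
  have hdf : ContDiff ℝ 1 fun v => fderiv ℝ f v (e j) :=
    (hf.fderiv_right (m := 1) (by norm_num)).clm_apply contDiff_const
  have hf2 : HasDerivAt (fun s : ℝ => fderiv ℝ f (h + s • e j) (e j))
      (fderiv ℝ (fun v => fderiv ℝ f v (e j)) (h + (0 : ℝ) • e j) (e j)) 0 :=
    ((hdf.differentiable (by simp)) _).hasFDerivAt.comp_hasDerivAt 0
      (hasDerivAt_add_smul h (e j) 0)
  have hreg0 : ∀ i, Real.sin (P.toLinearMap (P.root i) (h + (0 : ℝ) • e j) / 2) ≠ 0 := by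
    simpa using hreg
  have hg0 := (hasDerivAt_groundState b k h (e j) hreg0).ofReal_comp
  have hG0 := (hasDerivAt_logDerivGroundState b k h (e j) hreg0).ofReal_comp
  refine fderiv_fderiv_apply_eq_of_hasDerivAt hF
    (f₁ := fun s => fderiv ℝ f (h + s • e j) (e j) * (groundState P b k (proj P (h + s • e j)) : ℂ)
      + f (h + s • e j) * ((groundState P b k (proj P (h + s • e j)) : ℂ) *
        (logDerivGroundState P b k (e j) (h + s • e j) : ℂ))) ?_ ?_
  · filter_upwards [eventually_sin_ne_zero (e j) hreg] with s hs
    have hg := (hasDerivAt_groundState b k h (e j) hs).ofReal_comp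
    refine ((hf1 s).mul hg).congr_deriv ?_
    push_cast
    ring
  · refine ((hf2.mul hg0).add ((hf1 0).mul (hg0.fun_mul hG0))).congr_deriv ?_
    simp only [zero_smul, add_zero]
    push_cast
    ring

lemma sum_root_smul_eq_dualVec {κ : Type*} [Fintype κ] (e : OrthonormalBasis κ ℝ V) (x : M) :
    ∑ j, P.toLinearMap x (e j) • e j = dualVec P x := by
  rw [← e.sum_repr (dualVec P x)]
  refine Finset.sum_congr rfl fun j _ => ?_
  rw [e.repr_apply_apply, real_inner_comm, inner_dualVec]

/-- The eigenvalue of the ground state. -/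
def groundEnergy (P : RootPairing ι ℝ M V) [P.IsCrystallographic] [P.IsReduced]
    (b : P.Base) (k : ι → ℝ) : ℝ :=
  open scoped Classical in
  (∑ i ∈ positiveRoots P b, ∑ j ∈ (positiveRoots P b).erase i,
      k i * k j * dualForm P (P.root i) (P.root j)) / 4
    + ∑ i ∈ positiveRoots P b,
      dualForm P (P.root i) (P.root i) * (k i ^ 2 / 4 - k i * (k i - 1) / 12)

lemma potential_proj (b : P.Base) (k : ι → ℝ) (h : V) : potential P b k (proj P h)
    = ∑ i ∈ positiveRoots P b, k i * (k i - 1) * dualForm P (P.root i) (P.root i) *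
      (1 / (4 * Real.sin (P.toLinearMap (P.root i) h / 2) ^ 2) - 1 / 12) := by
  simp only [potential, absSin_proj, sq_abs, rootNormSq_eq_dualForm]

lemma sum_logDerivGroundState_sq_eq [P.IsRootSystem] (hinner : IsInvariantInner P) (b : P.Base)
    {k : ι → ℝ} (hkW : IsInvariantMult P k) {κ : Type*} [Fintype κ] (e : OrthonormalBasis κ ℝ V)
    {h : V} (hreg : ∀ i, Real.sin (P.toLinearMap (P.root i) h / 2) ≠ 0) :
    ∑ j, (logDerivGroundState P b k (e j) h ^ 2 + ∑ i ∈ positiveRoots P b,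
          -(k i * (P.toLinearMap (P.root i) (e j)) ^ 2 /
            (4 * Real.sin (P.toLinearMap (P.root i) h / 2) ^ 2)))
      = potential P b k (proj P h) - groundEnergy P b k := by
  classical
  set s := positiveRoots P b
  set c : ι → ℝ := fun i => Real.cot (P.toLinearMap (P.root i) h / 2) with hc
  have h1 : ∑ j, logDerivGroundState P b k (e j) h ^ 2
      = ∑ i ∈ s, ∑ l ∈ s, k i * k l * dualForm P (P.root i) (P.root l) * (c i * c l) / 4 := by
    simp only [logDerivGroundState, sq, Finset.sum_mul_sum]
    rw [Finset.sum_comm]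
    refine Finset.sum_congr rfl fun i _ => ?_
    rw [Finset.sum_comm]
    refine Finset.sum_congr rfl fun l _ => ?_
    rw [← sum_mul_eq_dualForm P e, Finset.mul_sum, Finset.sum_mul, Finset.sum_div]
    refine Finset.sum_congr rfl fun j _ => ?_
    simp only [hc]
    ring
  have h2 : ∑ j, ∑ i ∈ s, -(k i * (P.toLinearMap (P.root i) (e j)) ^ 2 /
            (4 * Real.sin (P.toLinearMap (P.root i) h / 2) ^ 2))
      = ∑ i ∈ s, -(k i * dualForm P (P.root i) (P.root i) /
            (4 * Real.sin (P.toLinearMap (P.root i) h / 2) ^ 2)) := by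
    rw [Finset.sum_comm]
    refine Finset.sum_congr rfl fun i _ => ?_
    rw [← sum_mul_eq_dualForm P e, Finset.mul_sum, Finset.sum_div, ← Finset.sum_neg_distrib]
    simp only [sq]
  have h3 : ∑ i ∈ s, ∑ l ∈ s, k i * k l * dualForm P (P.root i) (P.root l) * (c i * c l) / 4
      = ∑ i ∈ s, k i * k i * dualForm P (P.root i) (P.root i) * (c i * c i) / 4
        - (∑ i ∈ s, ∑ j ∈ s.erase i, k i * k j * dualForm P (P.root i) (P.root j)) / 4 := by
    rw [sub_eq_add_neg, ← neg_div, ← sum_cot_mul_cot hinner b hkW hreg, Finset.sum_div,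
      ← Finset.sum_add_distrib]
    refine Finset.sum_congr rfl fun i hi => ?_
    rw [← Finset.add_sum_erase _ _ hi, Finset.sum_div]
  rw [Finset.sum_add_distrib, h1, h2, h3, potential_proj, groundEnergy]
  rw [show ∀ x y z w v : ℝ, x - y / 4 + z = w - (y / 4 + v) ↔ x + z = w - v from
    fun x y z w v => ⟨fun H => by linarith, fun H => by linarith⟩]
  rw [← Finset.sum_add_distrib, ← Finset.sum_sub_distrib]
  refine Finset.sum_congr rfl fun i _ => ?_
  have hs := hreg i
  simp only [hc, Real.cot_eq_cos_div_sin]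
  have hcs := Real.sin_sq_add_cos_sq (P.toLinearMap (P.root i) h / 2)
  field_simp
  linear_combination (12 * k i ^ 2 * dualForm P (P.root i) (P.root i)) * hcs

/-- Conjugation of the Hamiltonian by the ground state. -/
theorem hamiltonian_mul_groundState [P.IsRootSystem] (hinner : IsInvariantInner P) (b : P.Base)
    {k : ι → ℝ} (hkW : IsInvariantMult P k) (hk : ∀ i, 2 ≤ k i) {q : Torus P → ℂ}
    (hq : IsC2 P q) {h : V} (hreg : ∀ i, Real.sin (P.toLinearMap (P.root i) h / 2) ≠ 0) :
    -laplacianT P (fun t => q t * (groundState P b k t : ℂ)) (proj P h)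
        + (potential P b k (proj P h) : ℂ) * (q (proj P h) * (groundState P b k (proj P h) : ℂ))
      = (-laplacianT P q (proj P h)
          - ∑ i ∈ positiveRoots P b, k i * (Real.cot (P.toLinearMap (P.root i) h / 2) *
            dirDeriv P (dualVec P (P.root i)) q (proj P h))
          + groundEnergy P b k * q (proj P h)) * (groundState P b k (proj P h) : ℂ) := by
  set e := stdOrthonormalBasis ℝ V
  rw [laplacianT_proj, laplacian_mul_groundState e b hk hq hreg, ← Complex.ofReal_sum,
    sum_logDerivGroundState_sq_eq hinner b hkW e hreg, laplacianT_proj]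
  have hsum : 2 * ∑ j, (logDerivGroundState P b k (e j) h : ℂ) *
        fderiv ℝ (fun v => q (proj P v)) h (e j)
      = ∑ i ∈ positiveRoots P b, k i * (Real.cot (P.toLinearMap (P.root i) h / 2) *
            dirDeriv P (dualVec P (P.root i)) q (proj P h)) := by
    simp only [logDerivGroundState, Complex.ofReal_sum, Finset.sum_mul]
    rw [Finset.sum_comm, Finset.mul_sum]
    refine Finset.sum_congr rfl fun i _ => ?_
    rw [dirDeriv_proj, ← sum_root_smul_eq_dualVec e, map_sum, Finset.mul_sum, Finset.mul_sum,
      Finset.mul_sum]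
    refine Finset.sum_congr rfl fun j _ => ?_
    rw [map_smul, Complex.real_smul]
    push_cast
    ring
  rw [hsum]
  push_cast
  ring

end GroundStateConjugation
section Isometries

variable {V : Type*} [NormedAddCommGroup V] [InnerProductSpace ℝ V] [FiniteDimensional ℝ V]

lemma fderiv_apply_of_comp_eq {f : V → ℂ} (hf : Differentiable ℝ f) (L : V →L[ℝ] V)
    {g : V → ℂ} (hL : ∀ v, f (L v) = g v) (v e : V) : fderiv ℝ g v e = fderiv ℝ f (L v) (L e) := by
  have h : g = f ∘ L := funext fun v => (hL v).symm
  rw [h, fderiv_comp _ (hf _) L.differentiableAt, L.fderiv]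
  rfl

lemma laplacian_of_comp_eq {f : V → ℂ} (hf : ContDiff ℝ 2 f) (L : V ≃ₗᵢ[ℝ] V)
    (hL : ∀ v, f (L v) = f v) (v : V) :
    Laplacian.laplacian f (L v) = Laplacian.laplacian f v := by
  have e := stdOrthonormalBasis ℝ V
  rw [laplacian_eq_sum_fderiv_fderiv (e.map L) hf.contDiffAt,
    laplacian_eq_sum_fderiv_fderiv e hf.contDiffAt]
  refine Finset.sum_congr rfl fun j _ => ?_
  have hL' : ∀ v, f ((L : V →L[ℝ] V) v) = f v := hL
  have hd : ContDiff ℝ 1 fun v => fderiv ℝ f v (L (e j)) :=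
    (hf.fderiv_right (m := 1) (by norm_num)).clm_apply contDiff_const
  have h1 : ∀ v, (fun v => fderiv ℝ f v (L (e j))) ((L : V →L[ℝ] V) v) = fderiv ℝ f v (e j) :=
    fun v => (fderiv_apply_of_comp_eq (hf.differentiable (by simp)) (L : V →L[ℝ] V) hL' v (e j)).symm
  rw [OrthonormalBasis.map_apply]
  exact (fderiv_apply_of_comp_eq (hd.differentiable (by simp)) (L : V →L[ℝ] V) h1 v (e j)).symm

end Isometries

section Triangularity

variable {ι M V : Type*} [Fintype ι] [AddCommGroup M] [Module ℝ M]
  [NormedAddCommGroup V] [InnerProductSpace ℝ V] [FiniteDimensional ℝ V]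
  {P : RootPairing ι ℝ M V}

/-- The trigonometric polynomials with frequencies of norm at most `R`. -/
def trigPolynomialsLE (P : RootPairing ι ℝ M V) (R : ℝ) : Submodule ℂ (Torus P → ℂ) :=
  Submodule.span ℂ (expWeight P '' {x | ‖dualVec P (x : M)‖ ≤ R})

lemma trigPolynomialsLE_mono {R S : ℝ} (h : R ≤ S) :
    trigPolynomialsLE P R ≤ trigPolynomialsLE P S :=
  Submodule.span_mono (Set.image_mono fun _ hx => le_trans hx h)

lemma trigPolynomialsLE_le (R : ℝ) : trigPolynomialsLE P R ≤ trigPolynomials P :=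
  Submodule.span_mono (Set.image_subset_range _ _)

lemma exists_mem_trigPolynomialsLE {q : Torus P → ℂ} (hq : q ∈ trigPolynomials P) :
    ∃ R, q ∈ trigPolynomialsLE P R := by
  induction hq using Submodule.span_induction with
  | mem y hy =>
    obtain ⟨x, rfl⟩ := hy
    exact ⟨‖dualVec P (x : M)‖, Submodule.subset_span ⟨x, le_refl ‖dualVec P (x : M)‖, rfl⟩⟩
  | zero => exact ⟨0, zero_mem _⟩
  | add y z _ _ hy hz =>
    obtain ⟨R, hR⟩ := hy
    obtain ⟨S, hS⟩ := hz
    exact ⟨max R S, add_mem (trigPolynomialsLE_mono (le_max_left _ _) hR)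
      (trigPolynomialsLE_mono (le_max_right _ _) hS)⟩
  | smul c y _ hy =>
    obtain ⟨R, hR⟩ := hy
    exact ⟨R, Submodule.smul_mem _ c hR⟩

lemma finite_weights_le [P.IsRootSystem] (R : ℝ) :
    {x : weightLattice P | ‖dualVec P (x : M)‖ ≤ R}.Finite := by
  classical
  choose n hn using fun (x : weightLattice P) (i : ι) => x.2 i
  have hinj : Function.Injective n := by
    intro x y hxy
    apply Subtype.ext
    refine (LinearMap.IsPerfPair.bijective_left P.toLinearMap).1 ?_
    refine LinearMap.ext_on_range (v := P.coroot) RootPairing.IsRootSystem.span_coroot_eq_top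
      fun i => ?_
    rw [hn, hn, hxy]
  refine Set.Finite.of_injOn (f := n)
    (t := Set.Icc (fun i => -⌈R * ‖P.coroot i‖⌉) fun i => ⌈R * ‖P.coroot i‖⌉) ?_ hinj.injOn
    (Set.finite_Icc _ _)
  intro x hx
  have hbound : ∀ i, |(n x i : ℝ)| ≤ R * ‖P.coroot i‖ := fun i => by
    rw [← hn, ← inner_dualVec]
    exact (abs_real_inner_le_norm _ _).trans
      (mul_le_mul_of_nonneg_right hx (norm_nonneg _))
  refine ⟨fun i => ?_, fun i => ?_⟩
  · have h1 := (abs_le.1 (hbound i)).1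
    have h2 := Int.le_ceil (R * ‖P.coroot i‖)
    have : ((-⌈R * ‖P.coroot i‖⌉ : ℤ) : ℝ) ≤ n x i := by push_cast; linarith
    exact_mod_cast this
  · have h1 := (abs_le.1 (hbound i)).2
    have h2 := Int.le_ceil (R * ‖P.coroot i‖)
    exact_mod_cast h1.trans h2

lemma hasFDerivAt_expWeight (x : weightLattice P) (h : V) :
    HasFDerivAt (fun v => expWeight P x (proj P v))
      ((Complex.I * expWeight P x (proj P h)) •
        Complex.ofRealCLM.comp (LinearMap.toContinuousLinearMap (P.toLinearMap (x : M)))) h := by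
  have h1 : HasFDerivAt (fun v : V => Complex.I * ((P.toLinearMap (x : M) v : ℝ) : ℂ))
      (Complex.I • Complex.ofRealCLM.comp
        (LinearMap.toContinuousLinearMap (P.toLinearMap (x : M)))) h :=
    (Complex.ofRealCLM.comp
      (LinearMap.toContinuousLinearMap (P.toLinearMap (x : M)))).hasFDerivAt.const_mul Complex.I
  refine h1.cexp.congr_fderiv ?_
  rw [smul_smul, mul_comm, expWeight_proj]

lemma isC2_expWeight (x : weightLattice P) : IsC2 P (expWeight P x) := by
  have h1 : ContDiff ℝ 2 fun v : V => Complex.I * ((P.toLinearMap (x : M) v : ℝ) : ℂ) :=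
    contDiff_const.mul (Complex.ofRealCLM.comp
      (LinearMap.toContinuousLinearMap (P.toLinearMap (x : M)))).contDiff
  exact h1.cexp

lemma isC2_of_mem_trigPolynomials {q : Torus P → ℂ} (hq : q ∈ trigPolynomials P) : IsC2 P q := by
  induction hq using Submodule.span_induction with
  | mem y hy => obtain ⟨x, rfl⟩ := hy; exact isC2_expWeight x
  | zero => exact contDiff_const
  | add y z _ _ hy hz => exact ContDiff.add hy hz
  | smul c y _ hy => exact ContDiff.const_smul c hy

lemma dirDeriv_expWeight (e : V) (x : weightLattice P) :
    dirDeriv P e (expWeight P x) = (Complex.I * (P.toLinearMap (x : M) e : ℝ)) • expWeight P x := by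
  ext t
  obtain ⟨h, rfl⟩ := proj_surjective P t
  rw [dirDeriv_proj, (hasFDerivAt_expWeight x h).fderiv]
  simp
  ring

lemma dirDeriv_add {F G : Torus P → ℂ} (hF : IsC2 P F) (hG : IsC2 P G) (e : V) :
    dirDeriv P e (F + G) = dirDeriv P e F + dirDeriv P e G := by
  ext t
  obtain ⟨h, rfl⟩ := proj_surjective P t
  rw [Pi.add_apply, dirDeriv_proj, dirDeriv_proj, dirDeriv_proj]
  have := fderiv_fun_add ((ContDiff.differentiable hF (by simp)) h)
    ((ContDiff.differentiable hG (by simp)) h)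
  simp only [Pi.add_apply]
  rw [this]
  rfl

lemma dirDeriv_smul {F : Torus P → ℂ} (hF : IsC2 P F) (c : ℂ) (e : V) :
    dirDeriv P e (c • F) = c • dirDeriv P e F := by
  ext t
  obtain ⟨h, rfl⟩ := proj_surjective P t
  rw [Pi.smul_apply, dirDeriv_proj, dirDeriv_proj]
  have := fderiv_fun_const_smul ((ContDiff.differentiable hF (by simp)) h) c
  simp only [Pi.smul_apply]
  rw [this]
  rfl

lemma dirDeriv_mem_trigPolynomialsLE {R : ℝ} {q : Torus P → ℂ} (hq : q ∈ trigPolynomialsLE P R)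
    (e : V) : dirDeriv P e q ∈ trigPolynomialsLE P R := by
  have hC2 : ∀ y ∈ trigPolynomialsLE P R, IsC2 P y := fun y hy =>
    isC2_of_mem_trigPolynomials (trigPolynomialsLE_le R hy)
  induction hq using Submodule.span_induction with
  | mem y hy =>
    obtain ⟨x, hx, rfl⟩ := hy
    rw [dirDeriv_expWeight]
    exact Submodule.smul_mem _ _ (Submodule.subset_span ⟨x, hx, rfl⟩)
  | zero =>
    have h0 := dirDeriv_smul (P := P) (F := 0) contDiff_const 0 e
    rw [smul_zero, zero_smul] at h0
    rw [h0]
    exact zero_mem _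
  | add y z hy hz hy' hz' =>
    rw [dirDeriv_add (hC2 y hy) (hC2 z hz)]
    exact add_mem hy' hz'
  | smul c y hy hy' =>
    rw [dirDeriv_smul (hC2 y hy)]
    exact Submodule.smul_mem _ c hy'

lemma laplacianT_mem_trigPolynomialsLE {R : ℝ} {q : Torus P → ℂ}
    (hq : q ∈ trigPolynomialsLE P R) : laplacianT P q ∈ trigPolynomialsLE P R := by
  have h : laplacianT P q = ∑ j, dirDeriv P (stdOrthonormalBasis ℝ V j)
      (dirDeriv P (stdOrthonormalBasis ℝ V j) q) := by
    ext t
    rw [Finset.sum_apply]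
    exact laplacianT_eq_sum_dirDeriv _
      (isC2_of_mem_trigPolynomials (trigPolynomialsLE_le R hq)) t
  rw [h]
  exact Submodule.sum_mem _ fun j _ =>
    dirDeriv_mem_trigPolynomialsLE (dirDeriv_mem_trigPolynomialsLE hq _) _

variable [P.IsCrystallographic]

/-- The weights on a root string between `λ` and `s_α λ` are not longer than `λ`. -/
lemma norm_dualVec_sub_le (hinner : IsInvariantInner P) (i : ι) {x : M} {n j : ℕ}
    (hx : P.toLinearMap x (P.coroot i) = n) (hj : j ≤ n) :
    ‖dualVec P (x - (j : ℝ) • P.root i)‖ ≤ ‖dualVec P x‖ := by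
  refine le_of_sq_le_sq ?_ (norm_nonneg _)
  have h1 := two_mul_dualForm_root hinner i x
  rw [hx] at h1
  have h2 : 0 ≤ dualForm P (P.root i) (P.root i) := real_inner_self_nonneg
  have h3 : ‖dualVec P (x - (j : ℝ) • P.root i)‖ ^ 2 = ‖dualVec P x‖ ^ 2
      - j * (2 * dualForm P x (P.root i)) + j ^ 2 * dualForm P (P.root i) (P.root i) := by
    rw [sub_eq_add_neg, ← neg_smul, dualVec_add, dualVec_smul, norm_add_sq_real, norm_smul,
      inner_smul_right, mul_pow, ← real_inner_self_eq_norm_sq (dualVec P (P.root i))]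
    simp only [dualForm, Real.norm_eq_abs, sq_abs]
    ring
  have hj' : (j : ℝ) ≤ n := by exact_mod_cast hj
  rw [h3, h1]
  nlinarith [mul_nonneg (mul_nonneg (Nat.cast_nonneg (α := ℝ) j) (sub_nonneg.2 hj')) h2]

lemma reflection_mem_weightLattice (i : ι) {x : M} (hx : x ∈ weightLattice P) :
    P.reflection i x ∈ weightLattice P := by
  obtain ⟨n, hn⟩ := hx i
  have h : P.reflection i x = x - (n : ℝ) • P.root i := by
    rw [P.reflection_apply, ← hn]
    rfl
  rw [h, Int.cast_smul_eq_zsmul ℝ]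
  exact sub_mem hx (AddSubgroup.zsmul_mem _ (root_mem_weightLattice P i) n)

lemma expWeight_coreflection (i : ι) (x y : weightLattice P)
    (hxy : (y : M) = P.reflection i x) (h : V) :
    expWeight P x (proj P (P.coreflection i h)) = expWeight P y (proj P h) := by
  rw [expWeight_proj, expWeight_proj, hxy, toLinearMap_reflection]

/-- `cot (α / 2) (e^λ - e^{s_α λ})` is a trigonometric polynomial, for `⟨λ, α^∨⟩ ≥ 0`. -/
lemma exists_cot_mul_expWeight_sub_of_nonneg (hinner : IsInvariantInner P) (i : ι) {R : ℝ}
    (x : weightLattice P) (hx : ‖dualVec P (x : M)‖ ≤ R) {n : ℕ}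
    (hn : P.toLinearMap (x : M) (P.coroot i) = n) :
    ∃ r ∈ trigPolynomialsLE P R, ∀ h : V, Real.sin (P.toLinearMap (P.root i) h / 2) ≠ 0 →
      (Real.cot (P.toLinearMap (P.root i) h / 2) : ℂ) *
        (expWeight P x (proj P h) - expWeight P x (proj P (P.coreflection i h))) = r (proj P h) := by
  set a : weightLattice P := ⟨P.root i, root_mem_weightLattice P i⟩ with ha
  have hmem : ∀ j ≤ n, expWeight P (x - j • a) ∈ trigPolynomialsLE P R := by
    intro j hj
    refine Submodule.subset_span ⟨_, ?_, rfl⟩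
    refine le_trans (le_of_eq_of_le ?_ (norm_dualVec_sub_le hinner i hn hj)) hx
    congr 2
    simp [ha, Nat.cast_smul_eq_nsmul]
  refine ⟨Complex.I • ∑ j ∈ Finset.range n, (expWeight P (x - j • a)
      + expWeight P (x - (j + 1) • a)), Submodule.smul_mem _ _ (Submodule.sum_mem _ fun j hj => ?_),
      fun h hs => ?_⟩
  · have := Finset.mem_range.1 hj
    exact add_mem (hmem _ (by omega)) (hmem _ (by omega))
  · set E := Complex.exp (Complex.I * (P.toLinearMap (P.root i) h : ℝ)) with hE
    set z := Complex.exp (-(Complex.I * (P.toLinearMap (P.root i) h : ℝ))) with hz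
    have hEz : E * z = 1 := by rw [hE, hz, ← Complex.exp_add, add_neg_cancel, Complex.exp_zero]
    have hpow : ∀ j : ℕ, expWeight P (x - j • a) (proj P h) = expWeight P x (proj P h) * z ^ j := by
      intro j
      rw [expWeight_proj, expWeight_proj, hz, ← Complex.exp_nat_mul, ← Complex.exp_add]
      congr 1
      simp [ha]
      ring
    have hrefl : expWeight P x (proj P (P.coreflection i h)) = expWeight P x (proj P h) * z ^ n := by
      rw [← hpow, expWeight_proj, expWeight_proj, P.coreflection_apply]
      congr 3
      simp [ha, hn]
      ring
    have hE1 : E - 1 ≠ 0 := by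
      intro h0
      have h1 : E = 1 := sub_eq_zero.1 h0
      rw [hE, Complex.exp_eq_one_iff] at h1
      obtain ⟨m, hm⟩ := h1
      have h2 : (Complex.I * (P.toLinearMap (P.root i) h : ℝ) : ℂ)
          = Complex.I * (m * (2 * Real.pi) : ℝ) := by rw [hm]; push_cast; ring
      have h3 : P.toLinearMap (P.root i) h = m * (2 * Real.pi) := by
        exact_mod_cast mul_left_cancel₀ Complex.I_ne_zero h2
      apply hs
      rw [h3, show (m * (2 * Real.pi) / 2 : ℝ) = m * Real.pi by ring, Real.sin_int_mul_pi]
    have hcot := exp_add_one_div_exp_sub_one (P.toLinearMap (P.root i) h)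
    rw [← hE, div_eq_iff hE1] at hcot
    have hgeom := mul_neg_geom_sum z n
    simp only [Pi.smul_apply, Finset.sum_apply, Pi.add_apply, hpow, hrefl, smul_eq_mul]
    have hsum : ∑ j ∈ Finset.range n, (expWeight P x (proj P h) * z ^ j
        + expWeight P x (proj P h) * z ^ (j + 1))
        = expWeight P x (proj P h) * (1 + z) * ∑ j ∈ Finset.range n, z ^ j := by
      rw [Finset.mul_sum]
      exact Finset.sum_congr rfl fun j _ => by ring
    rw [hsum]
    have hz1 : (1 : ℂ) + z = -Complex.I * (Real.cot (P.toLinearMap (P.root i) h / 2) : ℝ) * (1 - z) := by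
      linear_combination z * hcot + (-1 - Complex.I *
        (Real.cot (P.toLinearMap (P.root i) h / 2) : ℝ)) * hEz
    rw [hz1]
    linear_combination (-(Real.cot (P.toLinearMap (P.root i) h / 2) : ℂ) *
      expWeight P x (proj P h)) * hgeom + (Real.cot (P.toLinearMap (P.root i) h / 2) : ℂ) *
      expWeight P x (proj P h) * (1 - z) * (∑ j ∈ Finset.range n, z ^ j) * Complex.I_sq

lemma exists_cot_mul_expWeight_sub (hinner : IsInvariantInner P) (i : ι) {R : ℝ}
    (x : weightLattice P) (hx : ‖dualVec P (x : M)‖ ≤ R) :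
    ∃ r ∈ trigPolynomialsLE P R, ∀ h : V, Real.sin (P.toLinearMap (P.root i) h / 2) ≠ 0 →
      (Real.cot (P.toLinearMap (P.root i) h / 2) : ℂ) *
        (expWeight P x (proj P h) - expWeight P x (proj P (P.coreflection i h))) = r (proj P h) := by
  obtain ⟨n, hn⟩ := x.2 i
  rcases le_total 0 n with h0 | h0
  · obtain ⟨m, rfl⟩ := Int.eq_ofNat_of_zero_le h0
    exact exists_cot_mul_expWeight_sub_of_nonneg hinner i x hx (n := m) (by exact_mod_cast hn)
  · obtain ⟨m, hm⟩ := Int.eq_ofNat_of_zero_le (neg_nonneg.2 h0)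
    set y : weightLattice P := ⟨P.reflection i x, reflection_mem_weightLattice i x.2⟩ with hy'
    have hnorm : ‖dualVec P (y : M)‖ ≤ R := by
      refine le_of_eq_of_le ?_ hx
      have h1 := dualForm_reflection hinner i (x : M) x
      rw [dualForm, dualForm, real_inner_self_eq_norm_sq, real_inner_self_eq_norm_sq] at h1
      exact (sq_eq_sq₀ (norm_nonneg _) (norm_nonneg _)).1 h1
    have hyn : P.toLinearMap (y : M) (P.coroot i) = m := by
      have : (m : ℝ) = -n := by
        have : (m : ℤ) = -n := by simpa using hm.symm
        exact_mod_cast this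
      rw [hy', this]
      simp only
      rw [toLinearMap_reflection, P.coreflection_apply_self, map_neg, hn]
    obtain ⟨r, hr, hr'⟩ := exists_cot_mul_expWeight_sub_of_nonneg hinner i y hnorm hyn
    refine ⟨-r, neg_mem hr, fun h hs => ?_⟩
    have hxy : (x : M) = P.reflection i (y : M) := by
      rw [hy']
      simp
    rw [expWeight_coreflection i x y rfl, ← expWeight_coreflection i y x hxy, Pi.neg_apply,
      ← hr' h hs]
    ring

lemma exists_cot_mul_dirDeriv_sub (hinner : IsInvariantInner P) (i : ι) {R : ℝ}
    {q : Torus P → ℂ} (hq : q ∈ trigPolynomialsLE P R) (e : V) :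
    ∃ r ∈ trigPolynomialsLE P R, ∀ h : V, Real.sin (P.toLinearMap (P.root i) h / 2) ≠ 0 →
      (Real.cot (P.toLinearMap (P.root i) h / 2) : ℂ) *
        (dirDeriv P e q (proj P h) - dirDeriv P e q (proj P (P.coreflection i h)))
          = r (proj P h) := by
  have key : ∀ q ∈ trigPolynomialsLE P R, ∃ r ∈ trigPolynomialsLE P R, ∀ h : V,
      Real.sin (P.toLinearMap (P.root i) h / 2) ≠ 0 →
      (Real.cot (P.toLinearMap (P.root i) h / 2) : ℂ) *
        (q (proj P h) - q (proj P (P.coreflection i h))) = r (proj P h) := by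
    intro q hq
    induction hq using Submodule.span_induction with
    | mem y hy =>
      obtain ⟨x, hx, rfl⟩ := hy
      exact exists_cot_mul_expWeight_sub hinner i x hx
    | zero => exact ⟨0, zero_mem _, fun h _ => by simp⟩
    | add y z _ _ hy hz =>
      obtain ⟨r, hr, hr'⟩ := hy
      obtain ⟨s, hs, hs'⟩ := hz
      refine ⟨r + s, add_mem hr hs, fun h hh => ?_⟩
      rw [Pi.add_apply, Pi.add_apply, Pi.add_apply, ← hr' h hh, ← hs' h hh]
      ring
    | smul c y _ hy =>
      obtain ⟨r, hr, hr'⟩ := hy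
      refine ⟨c • r, Submodule.smul_mem _ c hr, fun h hh => ?_⟩
      rw [Pi.smul_apply, Pi.smul_apply, Pi.smul_apply, ← hr' h hh, smul_eq_mul, smul_eq_mul,
        smul_eq_mul]
      ring
  exact key _ (dirDeriv_mem_trigPolynomialsLE hq e)

/-- `cot (α / 2) ∂_α q` is a trigonometric polynomial for every invariant trigonometric
polynomial `q`. -/
lemma exists_cot_mul_dirDeriv (hinner : IsInvariantInner P) (i : ι) {R : ℝ}
    {q : Torus P → ℂ} (hq : q ∈ trigPolynomialsLE P R) (hW : IsWeylInvariant P q) :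
    ∃ r ∈ trigPolynomialsLE P R, ∀ h : V, Real.sin (P.toLinearMap (P.root i) h / 2) ≠ 0 →
      (Real.cot (P.toLinearMap (P.root i) h / 2) : ℂ) *
        dirDeriv P (dualVec P (P.root i)) q (proj P h) = r (proj P h) := by
  obtain ⟨r, hr, hr'⟩ := exists_cot_mul_dirDeriv_sub hinner i hq (dualVec P (P.root i))
  refine ⟨(1 / 2 : ℂ) • r, Submodule.smul_mem _ _ hr, fun h hs => ?_⟩
  have hC2 := isC2_of_mem_trigPolynomials (trigPolynomialsLE_le R hq)
  have hanti : dirDeriv P (dualVec P (P.root i)) q (proj P (P.coreflection i h))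
      = -dirDeriv P (dualVec P (P.root i)) q (proj P h) := by
    rw [dirDeriv_proj, dirDeriv_proj, fderiv_apply_of_comp_eq (f := fun v => q (proj P v))
      (g := fun v => q (proj P v)) (ContDiff.differentiable hC2 (by simp))
      (LinearMap.toContinuousLinearMap (P.coreflection i : V →ₗ[ℝ] V))
      (fun v => hW.coreflection i v) h]
    have : (LinearMap.toContinuousLinearMap (P.coreflection i : V →ₗ[ℝ] V)) (dualVec P (P.root i))
        = -dualVec P (P.root i) := by
      rw [← dualVec_neg, ← P.reflection_apply_self, dualVec_reflection hinner]
      rfl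
    rw [this, map_neg, neg_neg]
    rfl
  rw [Pi.smul_apply, ← hr' h hs, hanti, smul_eq_mul]
  ring

end Triangularity

section Invariance

variable {ι M V : Type*} [Fintype ι] [AddCommGroup M] [Module ℝ M]
  [NormedAddCommGroup V] [InnerProductSpace ℝ V] [FiniteDimensional ℝ V]
  {P : RootPairing ι ℝ M V}

lemma laplacianT_coreflection (hinner : IsInvariantInner P) {F : Torus P → ℂ} (hF : IsC2 P F)
    (hW : IsWeylInvariant P F) (i : ι) (h : V) :
    laplacianT P F (proj P (P.coreflection i h)) = laplacianT P F (proj P h) := by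
  rw [laplacianT_proj, laplacianT_proj]
  exact laplacian_of_comp_eq (f := fun v => F (proj P v)) hF
    ((P.coreflection i).isometryOfInner (hinner _ (coreflection_mem_weylGroup P i)))
    (fun v => hW.coreflection i v) h

variable [P.IsRootSystem] [P.IsCrystallographic] [P.IsReduced]

lemma potential_coreflection (hinner : IsInvariantInner P) (b : P.Base) {k : ι → ℝ}
    (hk : IsInvariantMult P k) (i : ι) (h : V) :
    potential P b k (proj P (P.coreflection i h)) = potential P b k (proj P h) := by
  have hnorm : ∀ i j, rootNormSq P (P.reflectionPerm i j) = rootNormSq P j := fun i j => by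
    rw [rootNormSq_eq_dualForm, rootNormSq_eq_dualForm, P.root_reflectionPerm,
      dualForm_reflection hinner]
  have hsum : ∀ t : Torus P, potential P b k t + potential P b k t
      = ∑ j, k j * (k j - 1) * rootNormSq P j * (1 / (4 * absSin P j t ^ 2) - 1 / 12) :=
    fun t => by
      refine (sum_eq_sum_positiveRoots_add_self b _ fun j => ?_).symm
      rw [absSin_reflectionPerm_self, hk.reflectionPerm, hnorm]
  have h2 : potential P b k (proj P (P.coreflection i h)) +
      potential P b k (proj P (P.coreflection i h))
      = potential P b k (proj P h) + potential P b k (proj P h) := by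
    rw [hsum, hsum]
    refine Fintype.sum_equiv (P.reflectionPerm i) _ _ fun j => ?_
    rw [absSin_reflectionPerm, hk.reflectionPerm, hnorm]
  linarith

lemma isWeylInvariant_mul_groundState (b : P.Base) {k : ι → ℝ} (hk : IsInvariantMult P k)
    {q : Torus P → ℂ} (hq : IsWeylInvariant P q) :
    IsWeylInvariant P fun t => q t * (groundState P b k t : ℂ) := fun w t => by
  simp only [hq w t, groundState_weylTorus b hk w t]

lemma isC2_mul_groundState (b : P.Base) {k : ι → ℝ} (hk : ∀ i, 2 ≤ k i)
    {q : Torus P → ℂ} (hq : IsC2 P q) : IsC2 P fun t => q t * (groundState P b k t : ℂ) :=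
  ContDiff.mul hq (Complex.ofRealCLM.contDiff.comp (contDiff_groundState b hk))

/-- The Hamiltonian, conjugated by the ground state, preserves the space of invariant
trigonometric polynomials with frequencies of bounded norm. -/
theorem exists_hamiltonian_mul_groundState_eq (hinner : IsInvariantInner P) (b : P.Base)
    {k : ι → ℝ} (hkW : IsInvariantMult P k) (hk : ∀ i, 2 ≤ k i) {R : ℝ} {q : Torus P → ℂ}
    (hq : q ∈ trigPolynomialsLE P R) (hqW : IsWeylInvariant P q) :
    ∃ r ∈ trigPolynomialsLE P R, IsWeylInvariant P r ∧
      ∀ t, (∀ i, absSin P i t ≠ 0) →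
        -laplacianT P (fun t => q t * (groundState P b k t : ℂ)) t
          + (potential P b k t : ℂ) * (q t * (groundState P b k t : ℂ))
        = r t * (groundState P b k t : ℂ) := by
  have hC2 := isC2_of_mem_trigPolynomials (trigPolynomialsLE_le R hq)
  choose c hc hc' using fun i => exists_cot_mul_dirDeriv hinner i hq hqW
  set r : Torus P → ℂ := -laplacianT P q - ∑ i ∈ positiveRoots P b, (k i : ℂ) • c i
    + (groundEnergy P b k : ℂ) • q with hr
  have hrmem : r ∈ trigPolynomialsLE P R :=
    add_mem (sub_mem (neg_mem (laplacianT_mem_trigPolynomialsLE hq))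
      (Submodule.sum_mem _ fun i _ => Submodule.smul_mem _ _ (hc i))) (Submodule.smul_mem _ _ hq)
  have heq : ∀ t, (∀ i, absSin P i t ≠ 0) →
        -laplacianT P (fun t => q t * (groundState P b k t : ℂ)) t
          + (potential P b k t : ℂ) * (q t * (groundState P b k t : ℂ))
        = r t * (groundState P b k t : ℂ) := by
    intro t ht
    obtain ⟨h, rfl⟩ := proj_surjective P t
    have hreg : ∀ i, Real.sin (P.toLinearMap (P.root i) h / 2) ≠ 0 := fun i => by
      have := ht i
      rwa [absSin_proj, ne_eq, abs_eq_zero] at this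
    rw [hamiltonian_mul_groundState hinner b hkW hk hC2 hreg]
    congr 1
    simp only [hr, Pi.add_apply, Pi.sub_apply, Pi.neg_apply, Finset.sum_apply, Pi.smul_apply,
      smul_eq_mul, hc' _ h (hreg _)]
  refine ⟨r, hrmem, ?_, heq⟩
  have hrc : Continuous r := (isC2_of_mem_trigPolynomials (trigPolynomialsLE_le R hrmem)).continuous
  refine apply_weylTorus_of_coreflection fun i h => ?_
  set s : weylGroup P := ⟨P.coreflection i, coreflection_mem_weylGroup P i⟩
  suffices hfun : r ∘ weylTorus P s = r from congrFun hfun (proj P h)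
  have hsc := continuous_weylTorus P s
  rw [← (hrc.comp hsc).ae_eq_iff_eq (haarT P) hrc]
  have hreg : ∀ᵐ t ∂haarT P, ∀ i, absSin P i t ≠ 0 := ae_absSin_ne_zero
  filter_upwards [hreg, (measurePreserving_weylTorus P s).quasiMeasurePreserving.ae hreg] with t h1 h2
  have hpos : (groundState P b k t : ℂ) ≠ 0 := by
    exact_mod_cast (groundState_pos b k h1).ne'
  refine mul_right_cancel₀ hpos ?_
  have e1 := heq t h1
  have e2 := heq _ h2
  have hFW := isWeylInvariant_mul_groundState b hkW hqW
  have hF := isC2_mul_groundState b hk hC2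
  rw [← e1]
  rw [groundState_weylTorus b hkW] at e2
  simp only [Function.comp]
  rw [← e2]
  obtain ⟨g, rfl⟩ := proj_surjective P t
  have hg : weylTorus P s (proj P g) = proj P (P.coreflection i g) := rfl
  rw [hg, laplacianT_coreflection hinner hF hFW, potential_coreflection hinner b hkW,
    hqW.coreflection]

end Invariance
section Main

open scoped ComplexConjugate

variable {ι M V : Type*} [Fintype ι] [AddCommGroup M] [Module ℝ M]
  [NormedAddCommGroup V] [InnerProductSpace ℝ V] [FiniteDimensional ℝ V]
  {P : RootPairing ι ℝ M V} [P.IsRootSystem]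

lemma memLp_of_continuous {F : Torus P → ℂ} (hF : Continuous F) : MemLp F 2 (haarT P) := by
  obtain ⟨C, hC⟩ := isCompact_univ.exists_bound_of_continuousOn hF.continuousOn
  exact MemLp.of_bound hF.aestronglyMeasurable C (Eventually.of_forall fun t => hC t trivial)

lemma L2W_inner (f g : L2W P) : ⟪f, g⟫_ℂ = ∫ t, conj ((f : Lp ℂ 2 (haarT P)) t) *
    (g : Lp ℂ 2 (haarT P)) t ∂haarT P := by
  rw [Submodule.coe_inner, L2.inner_def]
  simp [mul_comm]

variable [P.IsCrystallographic] [P.IsReduced]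

lemma hamiltonianGraph_symmetric {b : P.Base} {k : ι → ℝ} {p r : L2W P × L2W P}
    (hp : p ∈ hamiltonianGraph P b k) (hr : r ∈ hamiltonianGraph P b k) :
    ⟪p.2, r.1⟫_ℂ = ⟪p.1, r.2⟫_ℂ := by
  obtain ⟨F, hF, -, hFV, hF1, hF2⟩ := hp
  obtain ⟨G, hG, -, hGV, hG1, hG2⟩ := hr
  rw [L2W_inner, L2W_inner]
  have e1 : ∫ t, conj ((p.2 : Lp ℂ 2 (haarT P)) t) * (r.1 : Lp ℂ 2 (haarT P)) t ∂haarT P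
      = ∫ t, (-(conj (laplacianT P F t) * G t)
        + conj ((potential P b k t : ℂ) * F t) * G t) ∂haarT P := by
    refine integral_congr_ae ?_
    filter_upwards [hF2, hG1] with t h1 h2
    rw [h1, h2, map_add, map_neg]
    ring
  have e2 : ∫ t, conj ((p.1 : Lp ℂ 2 (haarT P)) t) * (r.2 : Lp ℂ 2 (haarT P)) t ∂haarT P
      = ∫ t, (-(conj (F t) * laplacianT P G t)
        + conj (F t) * ((potential P b k t : ℂ) * G t)) ∂haarT P := by
    refine integral_congr_ae ?_
    filter_upwards [hF1, hG2] with t h1 h2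
    rw [h1, h2]
    ring
  have hF0 := hF.continuous
  have hG0 := hG.continuous
  have hLF := continuous_laplacianT hF
  have hLG := continuous_laplacianT hG
  have i1 : Integrable (fun t => conj ((potential P b k t : ℂ) * F t) * G t) (haarT P) :=
    MemLp.integrable_mul (p := 2) (q := 2) hFV.star (memLp_of_continuous hG0)
  have i2 : Integrable (fun t => conj (F t) * ((potential P b k t : ℂ) * G t)) (haarT P) :=
    MemLp.integrable_mul (p := 2) (q := 2) (memLp_of_continuous hF0).star hGV
  rw [e1, e2, integral_add (integrable_of_continuous (by fun_prop)) i1,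
    integral_add (integrable_of_continuous (by fun_prop)) i2, integral_neg, integral_neg,
    integral_conj_mul_laplacianT hF hG]
  congr 1
  refine integral_congr_ae (Eventually.of_forall fun t => ?_)
  simp only [map_mul, Complex.conj_ofReal]
  ring

/-- The Hamiltonian maps `q Δ` to some `r Δ`. -/
lemma exists_mem_hamiltonianGraph (hinner : IsInvariantInner P) (b : P.Base)
    {k : ι → ℝ} (hkW : IsInvariantMult P k) (hk : ∀ i, 2 ≤ k i) {R : ℝ} {q : Torus P → ℂ}
    (hq : q ∈ trigPolynomialsLE P R) (hqW : IsWeylInvariant P q) {f : L2W P}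
    (hf : ((f : Lp ℂ 2 (haarT P)) : Torus P → ℂ) =ᵐ[haarT P]
      fun t => q t * (groundState P b k t : ℂ)) :
    ∃ r ∈ trigPolynomialsLE P R, IsWeylInvariant P r ∧ ∃ g : L2W P,
      ((g : Lp ℂ 2 (haarT P)) : Torus P → ℂ) =ᵐ[haarT P]
        (fun t => r t * (groundState P b k t : ℂ)) ∧ (f, g) ∈ hamiltonianGraph P b k := by
  obtain ⟨r, hr, hrW, heq⟩ := exists_hamiltonian_mul_groundState_eq hinner b hkW hk hq hqW
  have hqC := isC2_of_mem_trigPolynomials (trigPolynomialsLE_le R hq)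
  have hrC := isC2_of_mem_trigPolynomials (trigPolynomialsLE_le R hr)
  have hF := isC2_mul_groundState b hk hqC
  have hG := isC2_mul_groundState b hk hrC
  have hGL := memLp_of_continuous hG.continuous
  have hae : ∀ᵐ t ∂haarT P, -laplacianT P (fun t => q t * (groundState P b k t : ℂ)) t
          + (potential P b k t : ℂ) * (q t * (groundState P b k t : ℂ))
        = r t * (groundState P b k t : ℂ) := by
    filter_upwards [ae_absSin_ne_zero] with t ht using heq t ht
  have hg := hGL.coeFn_toLp
  refine ⟨r, hr, hrW, ⟨hGL.toLp _, coe_mem_L2W_of_ae_eq hg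
    (isWeylInvariant_mul_groundState b hkW hrW)⟩, hg, _, hF,
    isWeylInvariant_mul_groundState b hkW hqW, ?_, hf, ?_⟩
  · refine (hGL.add (memLp_of_continuous (continuous_laplacianT hF))).ae_eq ?_
    filter_upwards [hae] with t ht
    simp only [Pi.add_apply]
    rw [← ht]
    ring
  · refine hg.trans ?_
    filter_upwards [hae] with t ht using ht.symm

lemma trigPolynomials_comp_weylTorus {q : Torus P → ℂ} (hq : q ∈ trigPolynomials P)
    (w : weylGroup P) : (fun t => q (weylTorus P w t)) ∈ trigPolynomials P := by
  have hx : ∀ x : weightLattice P, (fun t => expWeight P x (weylTorus P w t))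
      ∈ Set.range (expWeight P) := by
    obtain ⟨w, hw⟩ := w
    induction hw using Subgroup.closure_induction'' with
    | one => exact fun x => ⟨x, funext fun t => by
        obtain ⟨h, rfl⟩ := proj_surjective P t; rfl⟩
    | mem y hy =>
      obtain ⟨i, rfl⟩ := hy
      refine fun x => ⟨⟨P.reflection i x, reflection_mem_weightLattice i x.2⟩, funext fun t => ?_⟩
      obtain ⟨h, rfl⟩ := proj_surjective P t
      exact (expWeight_coreflection i x _ rfl h).symm
    | inv_mem y hy =>
      obtain ⟨i, rfl⟩ := hy
      refine fun x => ⟨⟨P.reflection i x, reflection_mem_weightLattice i x.2⟩, funext fun t => ?_⟩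
      obtain ⟨h, rfl⟩ := proj_surjective P t
      exact (expWeight_coreflection i x _ rfl h).symm
    | mul y z hy hz hy' hz' =>
      intro x
      obtain ⟨x', hx'⟩ := hy' x
      obtain ⟨x'', hx''⟩ := hz' x'
      refine ⟨x'', hx''.trans (funext fun t => ?_)⟩
      rw [hx']
      obtain ⟨h, rfl⟩ := proj_surjective P t
      rfl
  induction hq using Submodule.span_induction with
  | mem y hy => obtain ⟨x, rfl⟩ := hy; exact Submodule.subset_span (hx x)
  | zero => exact zero_mem _
  | add y z _ _ hy hz => exact add_mem hy hz
  | smul c y _ hy => exact Submodule.smul_mem _ c hy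

lemma weylTorus_mul (w w' : weylGroup P) (t : Torus P) :
    weylTorus P w (weylTorus P w' t) = weylTorus P (w * w') t := by
  obtain ⟨h, rfl⟩ := proj_surjective P t
  rfl

/-- Invariant trigonometric polynomials times the ground state are dense. -/
lemma dense_jacobiDomain (b : P.Base) {k : ι → ℝ} (hkW : IsInvariantMult P k)
    (hk : ∀ i, 2 ≤ k i) : Dense (jacobiDomain P b k : Set (L2W P)) := by
  rw [Submodule.dense_iff_topologicalClosure_eq_top, Submodule.topologicalClosure_eq_top_iff,
    Submodule.eq_bot_iff]
  intro f hf
  have := finite_weylGroup (P := P)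
  have := Fintype.ofFinite (weylGroup P)
  have hgsc := continuous_groundState b (k := k) fun i => by linarith [hk i]
  set g : Torus P → ℂ := ((f : Lp ℂ 2 (haarT P)) : Torus P → ℂ) with hg
  have hgL : MemLp g 2 (haarT P) := Lp.memLp _
  have hgW : ∀ w : weylGroup P, g ∘ weylTorus P w =ᵐ[haarT P] g := fun w => by
    have h1 := Lp.coeFn_compMeasurePreserving (f : Lp ℂ 2 (haarT P))
      (measurePreserving_weylTorus P w)
    rw [f.2 w] at h1
    exact h1.symm
  have hgΔ : MemLp (fun t => (groundState P b k t : ℂ) * g t) 2 (haarT P) := by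
    obtain ⟨C, hC⟩ := isCompact_univ.exists_bound_of_continuousOn hgsc.continuousOn
    refine MemLp.of_le_mul (c := C) hgL (by fun_prop) (Eventually.of_forall fun t => ?_)
    rw [norm_mul, Complex.norm_real]
    exact mul_le_mul_of_nonneg_right (hC t trivial) (norm_nonneg _)
  have hint : ∀ q : Torus P → ℂ, Continuous q →
      Integrable (fun t => conj (q t) * ((groundState P b k t : ℂ) * g t)) (haarT P) :=
    fun q hq => MemLp.integrable_mul (p := 2) (q := 2) (memLp_of_continuous hq).star hgΔ
  have horth : ∀ q ∈ trigPolynomials P, IsWeylInvariant P q →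
      ∫ t, conj (q t) * ((groundState P b k t : ℂ) * g t) ∂haarT P = 0 := by
    intro q hq hqW
    have hqc := (isC2_of_mem_trigPolynomials hq).continuous
    have hL : MemLp (fun t => q t * (groundState P b k t : ℂ)) 2 (haarT P) :=
      memLp_of_continuous (by fun_prop)
    have hmem := hf ⟨hL.toLp _, coe_mem_L2W_of_ae_eq hL.coeFn_toLp
      (isWeylInvariant_mul_groundState b hkW hqW)⟩ ⟨q, hq, hqW, hL.coeFn_toLp⟩
    rw [L2W_inner] at hmem
    rw [← hmem]
    refine integral_congr_ae ?_
    filter_upwards [hL.coeFn_toLp] with t ht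
    rw [ht, map_mul, Complex.conj_ofReal]
    ring
  have hzero : (fun t => (groundState P b k t : ℂ) * g t) =ᵐ[haarT P] 0 := by
    refine ae_eq_zero_of_forall_integral_expWeight b hgΔ fun x => ?_
    set q : Torus P → ℂ := fun t => ∑ w : weylGroup P, expWeight P x (weylTorus P w t) with hq
    have hqmem : q ∈ trigPolynomials P := by
      have : q = ∑ w : weylGroup P, fun t => expWeight P x (weylTorus P w t) := by
        ext t; simp [hq]
      rw [this]
      exact Submodule.sum_mem _ fun w _ =>
        trigPolynomials_comp_weylTorus (Submodule.subset_span ⟨x, rfl⟩) w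
    have hqW : IsWeylInvariant P q := fun w t => by
      simp only [hq, weylTorus_mul]
      exact Fintype.sum_equiv (Equiv.mulRight w) _ _ fun w' => rfl
    have h0 := horth q hqmem hqW
    have hcomp : ∀ w : weylGroup P,
        ∫ t, conj (expWeight P x (weylTorus P w t)) * ((groundState P b k t : ℂ) * g t) ∂haarT P
          = ∫ t, conj (expWeight P x t) * ((groundState P b k t : ℂ) * g t) ∂haarT P := by
      intro w
      have hmp := measurePreserving_weylTorus P w
      have hmeas := (hint _ (continuous_expWeight x)).aestronglyMeasurable
      rw [← hmp.map_eq] at hmeas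
      have h1 := integral_map hmp.measurable.aemeasurable hmeas
      rw [hmp.map_eq] at h1
      rw [h1]
      refine integral_congr_ae ?_
      filter_upwards [hgW w] with t ht
      simp only [Function.comp] at ht
      rw [ht, groundState_weylTorus b hkW]
    simp only [hq, map_sum, Finset.sum_mul] at h0
    rw [integral_finsetSum _ fun w _ => hint (fun t => expWeight P x (weylTorus P w t))
      ((continuous_expWeight x).comp (continuous_weylTorus P w)), Finset.sum_congr rfl
      fun w _ => hcomp w, Finset.sum_const, nsmul_eq_mul] at h0
    refine (mul_eq_zero.1 h0).resolve_left ?_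
    simp
  apply Subtype.ext
  apply Lp.ext
  refine EventuallyEq.trans ?_ (Lp.coeFn_zero _ _ _).symm
  filter_upwards [hzero, ae_absSin_ne_zero] with t h1 h2
  refine (mul_eq_zero.1 h1).resolve_left ?_
  exact_mod_cast (groundState_pos b k h2).ne'

/-- The elements `q Δ` with `q` invariant, with frequencies of norm at most `R`. -/
def jacobiDomainLE (P : RootPairing ι ℝ M V) [P.IsRootSystem] [P.IsCrystallographic] [P.IsReduced]
    (b : P.Base) (k : ι → ℝ) (R : ℝ) : Submodule ℂ (L2W P) where
  carrier := {f | ∃ q ∈ trigPolynomialsLE P R, IsWeylInvariant P q ∧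
    ((f : Lp ℂ 2 (haarT P)) : Torus P → ℂ) =ᵐ[haarT P] fun t => q t * (groundState P b k t : ℂ)}
  add_mem' := by
    rintro f g ⟨q, hq, hqW, hf⟩ ⟨r, hr, hrW, hg⟩
    refine ⟨q + r, add_mem hq hr, fun w t => ?_, ?_⟩
    · simp only [Pi.add_apply, hqW w t, hrW w t]
    · refine (Lp.coeFn_add _ _).trans ((hf.add hg).trans (Eventually.of_forall fun t => ?_))
      simp only [Pi.add_apply]
      ring
  zero_mem' := ⟨0, zero_mem _, fun w t => rfl, (Lp.coeFn_zero _ _ _).trans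
    (Eventually.of_forall fun t => by simp)⟩
  smul_mem' := by
    rintro c f ⟨q, hq, hqW, hf⟩
    refine ⟨c • q, Submodule.smul_mem _ c hq, fun w t => ?_, ?_⟩
    · simp only [Pi.smul_apply, hqW w t]
    · refine (Lp.coeFn_smul _ _).trans
        ((hf.const_smul c).trans (Eventually.of_forall fun t => ?_))
      simp only [Pi.smul_apply, smul_eq_mul]
      ring

lemma finiteDimensional_jacobiDomainLE (b : P.Base) {k : ι → ℝ} (hk : ∀ i, 2 ≤ k i) (R : ℝ) :
    FiniteDimensional ℂ (jacobiDomainLE P b k R) := by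
  have hgsc := continuous_groundState b (k := k) fun i => by linarith [hk i]
  have hL : ∀ x : weightLattice P,
      MemLp (fun t => expWeight P x t * (groundState P b k t : ℂ)) 2 (haarT P) := fun x => by
    have := continuous_expWeight x
    exact memLp_of_continuous (by fun_prop)
  set S : Submodule ℂ (Lp ℂ 2 (haarT P)) :=
    Submodule.span ℂ ((fun x => (hL x).toLp _) '' {x | ‖dualVec P (x : M)‖ ≤ R}) with hS
  have hSfin : FiniteDimensional ℂ S :=
    FiniteDimensional.span_of_finite ℂ ((finite_weights_le R).image _)
  have key : ∀ q ∈ trigPolynomialsLE P R, ∃ f ∈ S,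
      (f : Torus P → ℂ) =ᵐ[haarT P] fun t => q t * (groundState P b k t : ℂ) := by
    intro q hq
    induction hq using Submodule.span_induction with
    | mem y hy =>
      obtain ⟨x, hx, rfl⟩ := hy
      exact ⟨_, Submodule.subset_span ⟨x, hx, rfl⟩, (hL x).coeFn_toLp⟩
    | zero => exact ⟨0, zero_mem _, (Lp.coeFn_zero _ _ _).trans
        (Eventually.of_forall fun t => by simp)⟩
    | add y z _ _ hy hz =>
      obtain ⟨f, hf, hf'⟩ := hy
      obtain ⟨g, hg, hg'⟩ := hz
      refine ⟨f + g, add_mem hf hg, (Lp.coeFn_add _ _).trans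
        ((hf'.add hg').trans (Eventually.of_forall fun t => ?_))⟩
      simp only [Pi.add_apply]
      ring
    | smul c y _ hy =>
      obtain ⟨f, hf, hf'⟩ := hy
      refine ⟨c • f, Submodule.smul_mem _ c hf, (Lp.coeFn_smul _ _).trans
        ((hf'.const_smul c).trans (Eventually.of_forall fun t => ?_))⟩
      simp only [Pi.smul_apply, smul_eq_mul]
      ring
  have hmem : ∀ f : jacobiDomainLE P b k R, ((L2W P).subtype ∘ₗ (jacobiDomainLE P b k R).subtype) f
      ∈ S := by
    rintro ⟨f, q, hq, -, hf⟩
    obtain ⟨g, hg, hg'⟩ := key q hq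
    have : (f : Lp ℂ 2 (haarT P)) = g := Lp.ext (hf.trans hg'.symm)
    simpa [this] using hg
  refine FiniteDimensional.of_injective
    (LinearMap.codRestrict S ((L2W P).subtype ∘ₗ (jacobiDomainLE P b k R).subtype) hmem) ?_
  intro f g hfg
  have h := congrArg (fun z : S => (z : Lp ℂ 2 (haarT P))) hfg
  exact Subtype.ext (Subtype.ext h)

end Main
end CalogeroSutherland
end

theorem mainTheorem3 {ι M V : Type*} [Fintype ι] [AddCommGroup M] [Module ℝ M]
    [NormedAddCommGroup V] [InnerProductSpace ℝ V] [FiniteDimensional ℝ V]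
    (P : RootPairing ι ℝ M V) [P.IsRootSystem] [P.IsCrystallographic] [P.IsReduced]
    (hinner : ∀ w ∈ CalogeroSutherland.weylGroup P, ∀ x y : V, ⟪w x, w y⟫_ℝ = ⟪x, y⟫_ℝ)
    (b : P.Base) (k : ι → ℝ)
    (hkW : ∀ (w : P.weylGroup) (i : ι), k (P.weylGroupToPerm w i) = k i)
    (hk : ∀ i, 2 ≤ k i) :
    CalogeroSutherland.jacobiDomain P b k ≤ (CalogeroSutherland.hamiltonian P b k).domain ∧
      CalogeroSutherland.IsEssentiallySelfAdjoint
        ((CalogeroSutherland.hamiltonian P b k).domRestrict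
          (CalogeroSutherland.jacobiDomain P b k)) := by
  open CalogeroSutherland in
  have hgraph : ∀ {R : ℝ} {q : Torus P → ℂ} {f : L2W P}, q ∈ trigPolynomialsLE P R →
      IsWeylInvariant P q → ((f : Lp ℂ 2 (haarT P)) : Torus P → ℂ) =ᵐ[haarT P]
        (fun t => q t * (groundState P b k t : ℂ)) →
      ∃ g ∈ jacobiDomainLE P b k R, (f, g) ∈ (hamiltonian P b k).graph := by
    intro R q f hq hqW hf
    obtain ⟨r, hr, hrW, g, hg, hfg⟩ := exists_mem_hamiltonianGraph hinner b hkW hk hq hqW hf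
    exact ⟨g, ⟨r, hr, hrW, hg⟩, by rwa [hamiltonian_graph]⟩
  have hle : CalogeroSutherland.jacobiDomain P b k
      ≤ (CalogeroSutherland.hamiltonian P b k).domain := by
    rintro f ⟨q, hq, hqW, hf⟩
    obtain ⟨R, hR⟩ := CalogeroSutherland.exists_mem_trigPolynomialsLE hq
    obtain ⟨g, -, hg⟩ := hgraph hR hqW hf
    exact LinearPMap.mem_domain_of_mem_graph hg
  set A := (CalogeroSutherland.hamiltonian P b k).domRestrict
    (CalogeroSutherland.jacobiDomain P b k) with hA
  have hdom : A.domain = CalogeroSutherland.jacobiDomain P b k := inf_eq_left.2 hle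
  have hAgraph : ∀ x : A.domain, ((x : CalogeroSutherland.L2W P), A x)
      ∈ (CalogeroSutherland.hamiltonian P b k).graph := fun x =>
    LinearPMap.le_graph_of_le LinearPMap.domRestrict_le (A.mem_graph x)
  refine ⟨hle, CalogeroSutherland.isEssentiallySelfAdjoint_of_locally_finite ?_ ?_ ?_⟩
  · rw [hdom]
    exact CalogeroSutherland.dense_jacobiDomain b hkW hk
  · intro x y
    have hx := hAgraph x
    have hy := hAgraph y
    rw [CalogeroSutherland.hamiltonian_graph] at hx hy
    exact CalogeroSutherland.hamiltonianGraph_symmetric hx hy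
  · rintro ⟨x, hx⟩
    have hx' := hx
    rw [hdom] at hx'
    obtain ⟨q, hq, hqW, hf⟩ := hx'
    obtain ⟨R, hR⟩ := CalogeroSutherland.exists_mem_trigPolynomialsLE hq
    refine ⟨CalogeroSutherland.jacobiDomainLE P b k R,
      CalogeroSutherland.finiteDimensional_jacobiDomainLE b hk R, ?_, ⟨q, hR, hqW, hf⟩, ?_⟩
    · rw [hdom]
      rintro f ⟨q, hq, hqW, hf⟩
      exact ⟨q, CalogeroSutherland.trigPolynomialsLE_le R hq, hqW, hf⟩
    · rintro y ⟨q, hq, hqW, hf⟩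
      obtain ⟨g, hg, hyg⟩ := hgraph hq hqW hf
      have : A y = g := LinearPMap.mem_graph_snd_inj _ (hAgraph y) hyg rfl
      rwa [this]
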